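/- Let $(\Omega,\mathcal F,\mathbb P)$ be a probability space, let $\sigma_1,\sigma_2>0$ and $\rho\in(-1,1)$ be constants, and let $B_1,B_2$ be standard Brownian motions on $[0,1]$ with correlation $\rho$, that is, $B_2=\rho B_1+\sqrt{1-\rho^2}\,B_3$ with $B_3$ a standard Brownian motion on $[0,1]$ independent of $B_1$. Let $X=(X_1,X_2)$ satisfy, almost surely for all $t\in[0,1]$ and for $\ell=1,2$, $$X_{\ell,t}=X_{\ell,0}+\sigma_\ell B_{\ell,t}+\int_0^t b_\ell(s,\omega)\,ds ,$$ where the drifts are bounded: $b_1,b_2\in L^\infty([0,1]\times\Omega,\,dt\otimes\mathbb P)$. For $n\ge1$ and $1\le k\le n$ put $\Delta^n_kX_\ell=X_{\ell,k/n}-X_{\ell,(k-1)/n}$, and let $$\beta^n_{\ell,1}(X)=\frac{\sum_{k=1}^n \Delta^n_kX_1\,\Delta^n_kX_2}{\sum_{k=1}^n(\Delta^n_kX_\ell)^2}$$ be the realized regression coefficient (with the convention $\beta^n_{\ell,1}(X)=0$ if the denominator vanishes). Then, for $\ell,\iota\in\{1,2\}$ with $\ell\neq\iota$, the sequence $(\beta^n_{\ell,1}(X))_{n\ge1}$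 satisfies the large deviation principle on $\mathbb R$ with speed $n$ and with the good rate function $$I(u)=\frac12\log\left(1+\frac{(\sigma_\ell u-\rho\sigma_\iota)^2}{\sigma_\iota^2(1-\rho^2)}\right),\qquad u\in\mathbb R .$$ That is, $I$ is lower semicontinuous with compact sublevel sets, and for every Borel set $A\subset\mathbb R$, $$-\inf_{u\in A^\circ}I(u)\le\liminf_{n\to\infty}\frac1n\log\mathbb P\big(\beta^n_{\ell,1}(X)\in A\big)\le\limsup_{n\to\infty}\frac1n\log\mathbb P\big(\beta^n_{\ell,1}(X)\in A\big)\le-\inf_{u\in\overline A}I(u).$$ -/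

import Mathlib

open MeasureTheory ProbabilityTheory Filter Set
open scoped ENNReal NNReal Topology

noncomputable section

/-- `B` restricted to the time interval `[0,1]` is a standard Brownian motion under `P`: it starts
at `0`, has independent increments with `B t - B s` of law `N(0, t - s)`, and almost surely
continuous paths. (The values of `B` outside `[0,1]` are irrelevant.) -/
structure IsStdBrownianOnUnit {Ω : Type*} [MeasurableSpace Ω] (P : Measure Ω)
    (B : ℝ → Ω → ℝ) : Prop where
  zero : ∀ᵐ ω ∂P, B 0 ω = 0
  indep_increments : HasIndepIncrements (fun (t : Icc (0 : ℝ) 1) ω => B t ω) P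
  law_increment : ∀ s t : ℝ, 0 ≤ s → s ≤ t → t ≤ 1 →
    HasLaw (fun ω => B t ω - B s ω) (gaussianReal 0 (t - s).toNNReal) P
  continuous_paths : ∀ᵐ ω ∂P, ContinuousOn (fun t => B t ω) (Icc 0 1)

/-- `B 0, B 1` are standard Brownian motions on `[0,1]` with constant correlation `ρ`:
`B 1 = ρ B 0 + √(1 - ρ²) W`, where `W` is a standard Brownian motion on `[0,1]`
independent of `B 0`. -/
def IsCorrelatedBrownianPair {Ω : Type*} [MeasurableSpace Ω] (P : Measure Ω) (ρ : ℝ)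
    (B : Fin 2 → ℝ → Ω → ℝ) : Prop :=
  IsStdBrownianOnUnit P (B 0) ∧
  ∃ W : ℝ → Ω → ℝ, IsStdBrownianOnUnit P W ∧
    IndepFun (fun ω (t : Icc (0 : ℝ) 1) => B 0 t ω) (fun ω (t : Icc (0 : ℝ) 1) => W t ω) P ∧
    ∀ᵐ ω ∂P, ∀ t ∈ Icc (0 : ℝ) 1, B 1 t ω = ρ * B 0 t ω + √(1 - ρ ^ 2) * W t ω

/-- The drift is essentially bounded: `b ∈ L^∞([0,1] × Ω, dt ⊗ P)`. -/
def IsBoundedDrift {Ω : Type*} [MeasurableSpace Ω] (P : Measure Ω) (b : ℝ → Ω → ℝ) : Prop :=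
  MemLp (fun p : ℝ × Ω => b p.1 p.2) ∞ ((volume.restrict (Icc (0 : ℝ) 1)).prod P)

/-- `dX_t = σ dB_t + b(t, ω) dt` on `[0,1]` with constant `σ`, in integral form:
almost surely, `X_t = X_0 + σ (B_t - B_0) + ∫_0^t b(s, ω) ds` for all `t ∈ [0,1]`. -/
def IsConstVolItoProcess {Ω : Type*} [MeasurableSpace Ω] (P : Measure Ω) (σ : ℝ)
    (B b X : ℝ → Ω → ℝ) : Prop :=
  ∀ᵐ ω ∂P, ∀ t ∈ Icc (0 : ℝ) 1,
    X t ω = X 0 ω + σ * (B t ω - B 0 ω) + ∫ s in (0 : ℝ)..t, b s ω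

/-- The increment `Z_{k/n} - Z_{(k-1)/n}`. -/
def gridIncrement {Ω : Type*} (Z : ℝ → Ω → ℝ) (n k : ℕ) (ω : Ω) : ℝ :=
  Z ((k : ℝ) / n) ω - Z (((k : ℝ) - 1) / n) ω

/-- Realized variance `∑_{k=1}^{⌊nt⌋} (Δ_k Z)²`. -/
def realizedVariance {Ω : Type*} (Z : ℝ → Ω → ℝ) (n : ℕ) (t : ℝ) (ω : Ω) : ℝ :=
  ∑ k ∈ Finset.Icc 1 ⌊(n : ℝ) * t⌋₊, gridIncrement Z n k ω ^ 2

/-- Realized covariance `∑_{k=1}^{⌊nt⌋} (Δ_k X_1)(Δ_k X_2)`. -/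
def realizedCovariance {Ω : Type*} (X : Fin 2 → ℝ → Ω → ℝ) (n : ℕ) (t : ℝ) (ω : Ω) : ℝ :=
  ∑ k ∈ Finset.Icc 1 ⌊(n : ℝ) * t⌋₊, gridIncrement (X 0) n k ω * gridIncrement (X 1) n k ω

/-- Realized regression coefficient: realized covariance over the realized variance of `X ℓ`. -/
def realizedRegression {Ω : Type*} (X : Fin 2 → ℝ → Ω → ℝ) (ℓ : Fin 2) (n : ℕ) (t : ℝ)
    (ω : Ω) : ℝ :=
  realizedCovariance X n t ω / realizedVariance (X ℓ) n t ω

/-- A rate function: a lower semicontinuous `[0,∞]`-valued function. It is good if, in addition,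
its sublevel sets are compact. -/
structure IsGoodRateFunction {S : Type*} [TopologicalSpace S] (I : S → ℝ≥0∞) : Prop where
  lowerSemicontinuous : LowerSemicontinuous I
  isCompact_sublevel : ∀ c : ℝ≥0, IsCompact {x | I x ≤ c}

/-- The random variables `M n` satisfy the large deviation principle with speed `r n → ∞` and rate
function `I`. Here `ENNReal.log 0 = ⊥` and the infimum over the empty set is `⊤`. -/
structure SatisfiesLDP {Ω S : Type*} [MeasurableSpace Ω] [TopologicalSpace S] [MeasurableSpace S]
    (P : Measure Ω) (M : ℕ → Ω → S) (r : ℕ → ℝ) (I : S → ℝ≥0∞) : Prop where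
  aemeasurable : ∀ n, AEMeasurable (M n) P
  speed_tendsto : Tendsto r atTop atTop
  lowerSemicontinuous : LowerSemicontinuous I
  lower_bound : ∀ A : Set S, MeasurableSet A →
    -(⨅ x ∈ interior A, (I x : EReal)) ≤
      liminf (fun n => (((r n)⁻¹ : ℝ) : EReal) * ENNReal.log (P {ω | M n ω ∈ A})) atTop
  upper_bound : ∀ A : Set S, MeasurableSet A →
    limsup (fun n => (((r n)⁻¹ : ℝ) : EReal) * ENNReal.log (P {ω | M n ω ∈ A})) atTop ≤
      -(⨅ x ∈ closure A, (I x : EReal))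

end

/-!
Rescaled by `√n`, the Brownian increments are `n` independent pairs `(ξ, ρ ξ + √(1 - ρ²) η)` with
`ξ`, `η` independent standard normal, and the regression coefficient is the least-squares slope of
`x₀ ξ + κ η` on `ξ`. It lies beyond `x = x₀ + κ c`, seen from `x₀`, if and only if
`∑ c ξ (η - c ξ) ≥ 0`. This is a sum of independent quadratic forms, whose moment generating
function at `s` is `(1 + c² s (2 - s)) ^ (-n / 2)`, smallest at `s = 1`, with logarithm
`-(n / 2) log (1 + c²)`. Markov's inequality and an exponential tilt turn this into matching upper
and lower bounds for the tails. Since the rate function is strictly increasing along rays from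
`x₀`, a ball around `x` is as likely, on the exponential scale, as the whole tail beyond `x`, and
the large deviation principle follows.

The rescaled drift increments have a bounded sum of squares. By Young's inequality they change the
sum of quadratic forms by at most `δ ∑ (ξ² + η²) + C`, where `δ > 0` is arbitrary, and so do not
affect the rates.
-/

section LargeDeviations

open ExpGrowth

variable {Ω : Type*} [MeasurableSpace Ω] {P : Measure Ω}

lemma expGrowthInf_add_le (u v : ℕ → ℝ≥0∞) :
    expGrowthInf (u + v) ≤ expGrowthInf u ⊔ expGrowthSup v := by
  refine le_of_forall_gt_imp_ge_of_dense fun a ha ↦ ?_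
  obtain ⟨hu, hv⟩ := max_lt_iff.1 ha
  set e : ℕ → ℝ≥0∞ := fun n ↦ EReal.exp (a * n)
  have hle : ∃ᶠ n in atTop, (u + v) n ≤ (e + e) n :=
    ((frequently_le_exp hu).and_eventually (eventually_le_exp hv)).mono
      fun n hn ↦ add_le_add hn.1 hn.2
  calc expGrowthInf (u + v) ≤ expGrowthSup (e + e) :=
        expGrowthInf_le_expGrowthSup_of_frequently_le hle
    _ = a := by rw [expGrowthSup_add, sup_idem, expGrowthSup_exp]

lemma le_expGrowthInf_of_le_add {u v w : ℕ → ℝ≥0∞} {c : EReal} (hw : w ≤ u + v)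
    (hc : c ≤ expGrowthInf w) (hv : expGrowthSup v < c) : c ≤ expGrowthInf u := by
  have h : c ≤ expGrowthInf u ⊔ expGrowthSup v :=
    (hc.trans (expGrowthInf_monotone hw)).trans (expGrowthInf_add_le u v)
  exact (le_sup_iff.1 h).resolve_right hv.not_ge

lemma expGrowthSup_ofReal_exp (a : ℝ) :
    expGrowthSup (fun n ↦ ENNReal.ofReal (Real.exp (n * a))) = a := by
  simp_rw [← EReal.exp_coe, EReal.coe_mul, mul_comm _ (a : EReal)]
  exact expGrowthSup_exp

lemma expGrowthSup_measure_ge_le {S : ℕ → Ω → ℝ} (hS : ∀ n, AEMeasurable (S n) P) (K : ℝ) :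
    expGrowthSup (fun n ↦ P {ω | K ≤ S n ω}) ≤
      expGrowthSup (fun n ↦ ∫⁻ ω, ENNReal.ofReal (Real.exp (S n ω)) ∂P) := by
  refine expGrowthSup_le_of_eventually_le (b := ENNReal.ofReal (Real.exp (-K)))
    ENNReal.ofReal_ne_top (Eventually.of_forall fun n ↦ ?_)
  rw [← lintegral_const_mul'' _ (by fun_prop)]
  have markov := mul_meas_ge_le_lintegral₀ (μ := P) (f := fun ω ↦
    ENNReal.ofReal (Real.exp (-K)) * ENNReal.ofReal (Real.exp (S n ω))) (by fun_prop) 1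
  rw [one_mul] at markov
  refine le_trans (measure_mono fun ω (hω : K ≤ S n ω) ↦ ?_) markov
  rw [mem_ofPred_eq, ← ENNReal.ofReal_mul (Real.exp_pos _).le, ← Real.exp_add]
  exact ENNReal.one_le_ofReal.2 (Real.one_le_exp (by linarith))

lemma expGrowthSup_lintegral_exp_add_le {S : ℕ → Ω → ℝ} (hS : ∀ n, AEMeasurable (S n) P) (a : ℝ) :
    expGrowthSup (fun n ↦ ∫⁻ ω, ENNReal.ofReal (Real.exp (S n ω + n * a)) ∂P) ≤
      expGrowthSup (fun n ↦ ∫⁻ ω, ENNReal.ofReal (Real.exp (S n ω)) ∂P) + a := by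
  have hmul : ∀ n, ∫⁻ ω, ENNReal.ofReal (Real.exp (S n ω + n * a)) ∂P =
      (∫⁻ ω, ENNReal.ofReal (Real.exp (S n ω)) ∂P) * ENNReal.ofReal (Real.exp (n * a)) := by
    intro n
    simp_rw [Real.exp_add, ENNReal.ofReal_mul (Real.exp_pos _).le]
    exact lintegral_mul_const'' _ (by fun_prop)
  simp_rw [hmul]
  rw [← expGrowthSup_ofReal_exp a]
  refine expGrowthSup_mul_le (.inr ?_) (.inr ?_) <;> rw [expGrowthSup_ofReal_exp]
  exacts [EReal.coe_ne_top a, EReal.coe_ne_bot a]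

/-- The half-line with endpoint `x` that points away from `x₀`; the whole line if `x = x₀`. -/
def awayTail (x₀ x : ℝ) : Set ℝ := {z | 0 ≤ (x - x₀) * (z - x)}

lemma exists_awayTail_subset_ball_union {x₀ x ε : ℝ} (hx : x ≠ x₀) (hε : 0 < ε) :
    ∃ t > 1, awayTail x₀ x ⊆ Metric.ball x ε ∪ awayTail x₀ (x₀ + t * (x - x₀)) := by
  have hd : 0 < |x - x₀| := abs_pos.2 (sub_ne_zero.2 hx)
  refine ⟨1 + ε / |x - x₀|, lt_add_of_pos_right 1 (div_pos hε hd), fun z hz ↦ ?_⟩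
  by_contra hcon
  simp only [awayTail, mem_union, Metric.mem_ball, mem_ofPred_eq, not_or, not_lt, not_le,
    Real.dist_eq] at hcon hz
  obtain ⟨hball, htail⟩ := hcon
  have hfar : |x - x₀| * ε ≤ (x - x₀) * (z - x) := by
    rw [← abs_of_nonneg hz, abs_mul]
    gcongr
  set r := ε / |x - x₀| with hr
  have hr0 : 0 < r := div_pos hε hd
  have hrε : |x - x₀| * ε = r * (x - x₀) ^ 2 := by
    rw [hr, ← sq_abs]; field_simp
  nlinarith [mul_pos hr0 (pow_pos hd 2), sq_abs (x - x₀)]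

lemma compl_ball_subset_awayTail (x₀ : ℝ) {ε : ℝ} (hε : 0 < ε) :
    (Metric.ball x₀ ε)ᶜ ⊆ awayTail x₀ (x₀ + ε) ∪ awayTail x₀ (x₀ - ε) := by
  intro z hz
  rw [mem_compl_iff, Metric.mem_ball, Real.dist_eq, not_lt, le_abs] at hz
  rcases hz with hz | hz
  · left; simp only [awayTail, mem_ofPred_eq]; nlinarith
  · right; simp only [awayTail, mem_ofPred_eq]; nlinarith

lemma exists_mem_closure_subset_awayTail {x₀ : ℝ} {s : Set ℝ} (hs : s.Nonempty)
    (hside : s ⊆ Ici x₀ ∨ s ⊆ Iic x₀) : ∃ y ∈ closure s, s ⊆ awayTail x₀ y := by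
  rcases hside with h | h
  · have hb : BddBelow s := ⟨x₀, h⟩
    refine ⟨sInf s, csInf_mem_closure hs hb, fun z hz ↦ ?_⟩
    exact mul_nonneg (sub_nonneg.2 (le_csInf hs h)) (sub_nonneg.2 (csInf_le hb hz))
  · have hb : BddAbove s := ⟨x₀, h⟩
    refine ⟨sSup s, csSup_mem_closure hs hb, fun z hz ↦ ?_⟩
    exact mul_nonneg_of_nonpos_of_nonpos (sub_nonpos.2 (csSup_le hs h))
      (sub_nonpos.2 (le_csSup hb hz))

section GartnerEllis

variable {S : ℕ → Ω → ℝ} {Λ : ℝ → ℝ} {s m x : ℝ}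

lemma exists_tilt_lt {Φ : ℝ → EReal} {δ : ℝ} (hδ : 0 < δ) (hΦ : ∀ᶠ t in 𝓝 s, Φ t ≤ Λ t)
    (hm : HasDerivAt Λ m s) :
    ∃ h > 0, Φ (s + h) + ↑(-(h * (m + δ))) < Λ s ∧ Φ (s - h) + ↑(h * (m - δ)) < Λ s := by
  have hlin : ∀ᶠ t in 𝓝 s, |Λ t - Λ s - (t - s) * m| ≤ δ / 2 * |t - s| := by
    simpa using hm.isLittleO.def (half_pos hδ)
  obtain ⟨ε, hε, hball⟩ := Metric.eventually_nhds_iff.1 (hΦ.and hlin)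
  have hh : 0 < ε / 2 := half_pos hε
  refine ⟨ε / 2, hh, ?_, ?_⟩
  · obtain ⟨hle, habs⟩ := @hball (s + ε / 2) (by simp [abs_of_pos hε, hε])
    refine (add_le_add_left hle _).trans_lt ?_
    rw [← EReal.coe_add, EReal.coe_lt_coe_iff]
    rw [add_sub_cancel_left, abs_of_pos hh] at habs
    nlinarith [le_of_abs_le habs]
  · obtain ⟨hle, habs⟩ := @hball (s - ε / 2) (by simp [abs_of_pos hε, hε])
    refine (add_le_add_left hle _).trans_lt ?_
    rw [← EReal.coe_add, EReal.coe_lt_coe_iff]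
    rw [sub_sub_cancel_left, abs_neg, abs_of_pos hh] at habs
    nlinarith [le_of_abs_le habs]

/-- A point far from `n * m` is charged to the tilt that pushes it further away. -/
lemma exp_mul_le_indicator_add_tilts (s m δ : ℝ) {h : ℝ} (hh : 0 ≤ h) (n : ℕ) (y : ℝ) :
    ENNReal.ofReal (Real.exp (s * y)) ≤
      {y : ℝ | n * (m - δ) < y}.indicator
        (fun _ ↦ ENNReal.ofReal (Real.exp (n * (s * m + |s| * δ)))) y +
      (ENNReal.ofReal (Real.exp ((s + h) * y + n * -(h * (m + δ)))) +
        ENNReal.ofReal (Real.exp ((s - h) * y + n * (h * (m - δ))))) := by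
  rcases le_or_gt y (n * (m - δ)) with hlow | hlow
  · refine le_add_left (le_add_left (ENNReal.ofReal_le_ofReal (Real.exp_le_exp.2 ?_)))
    nlinarith
  rcases le_or_gt (n * (m + δ)) y with hhigh | hhigh
  · refine le_add_left (le_add_right (ENNReal.ofReal_le_ofReal (Real.exp_le_exp.2 ?_)))
    nlinarith
  · rw [indicator_of_mem (by exact hlow)]
    refine le_add_right (ENNReal.ofReal_le_ofReal (Real.exp_le_exp.2 ?_))
    have hdist : |y - n * m| ≤ n * δ := abs_le.2 ⟨by linarith, by linarith⟩
    have hcorr : s * (y - n * m) ≤ |s| * (n * δ) :=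
      (le_abs_self _).trans (by rw [abs_mul]; gcongr)
    nlinarith

lemma sub_le_expGrowthInf_measure_gt (hS : ∀ n, AEMeasurable (S n) P)
    (hupper : ∀ᶠ t in 𝓝 s,
      expGrowthSup (fun n ↦ ∫⁻ ω, ENNReal.ofReal (Real.exp (t * S n ω)) ∂P) ≤ Λ t)
    (hlower : Λ s ≤ expGrowthInf fun n ↦ ∫⁻ ω, ENNReal.ofReal (Real.exp (s * S n ω)) ∂P)
    (hm : HasDerivAt Λ m s) {δ : ℝ} (hδ : 0 < δ) :
    ((Λ s - (s * m + |s| * δ) : ℝ) : EReal) ≤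
      expGrowthInf (fun n ↦ P {ω | n * (m - δ) < S n ω}) := by
  obtain ⟨h, hh, hright, hleft⟩ := exists_tilt_lt hδ hupper hm
  set E : ℕ → ℝ≥0∞ := fun n ↦ ENNReal.ofReal (Real.exp (n * (s * m + |s| * δ)))
  set A : ℕ → ℝ≥0∞ := fun n ↦ P {ω | n * (m - δ) < S n ω}
  set T₁ : ℕ → ℝ≥0∞ :=
    fun n ↦ ∫⁻ ω, ENNReal.ofReal (Real.exp ((s + h) * S n ω + n * -(h * (m + δ)))) ∂P
  set T₂ : ℕ → ℝ≥0∞ :=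
    fun n ↦ ∫⁻ ω, ENNReal.ofReal (Real.exp ((s - h) * S n ω + n * (h * (m - δ)))) ∂P
  have hsplit : (fun n ↦ ∫⁻ ω, ENNReal.ofReal (Real.exp (s * S n ω)) ∂P) ≤ E * A + (T₁ + T₂) := by
    intro n
    refine (lintegral_mono fun ω ↦
      exp_mul_le_indicator_add_tilts s m δ hh.le n (S n ω)).trans ?_
    rw [lintegral_add_right' _ (by fun_prop), lintegral_add_left' (by fun_prop)]
    exact add_le_add_left (lintegral_indicator_const_le {ω | n * (m - δ) < S n ω} _) _
  have htilts : expGrowthSup (T₁ + T₂) < Λ s := by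
    rw [expGrowthSup_add]
    exact max_lt
      ((expGrowthSup_lintegral_exp_add_le (fun n ↦ (hS n).const_mul _) _).trans_lt hright)
      ((expGrowthSup_lintegral_exp_add_le (fun n ↦ (hS n).const_mul _) _).trans_lt hleft)
  have hE : expGrowthSup E = (s * m + |s| * δ : ℝ) := expGrowthSup_ofReal_exp _
  have hprod : (Λ s : EReal) ≤ (s * m + |s| * δ : ℝ) + expGrowthInf A :=
    calc (Λ s : EReal) ≤ expGrowthInf (E * A) := le_expGrowthInf_of_le_add hsplit hlower htilts
      _ ≤ expGrowthSup E + expGrowthInf A := by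
        apply expGrowthInf_mul_le <;> rw [hE]
        exacts [.inl (EReal.coe_ne_bot _), .inl (EReal.coe_ne_top _)]
      _ = (s * m + |s| * δ : ℝ) + expGrowthInf A := by rw [hE]
  rw [EReal.coe_sub]
  exact EReal.sub_le_of_le_add' hprod

theorem le_expGrowthInf_measure_gt (hS : ∀ n, AEMeasurable (S n) P)
    (hupper : ∀ᶠ t in 𝓝 s,
      expGrowthSup (fun n ↦ ∫⁻ ω, ENNReal.ofReal (Real.exp (t * S n ω)) ∂P) ≤ Λ t)
    (hlower : Λ s ≤ expGrowthInf fun n ↦ ∫⁻ ω, ENNReal.ofReal (Real.exp (s * S n ω)) ∂P)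
    (hm : HasDerivAt Λ m s) (hx : x < m) :
    ((Λ s - s * m : ℝ) : EReal) ≤ expGrowthInf (fun n ↦ P {ω | n * x < S n ω}) := by
  have hlim : Tendsto (fun δ : ℝ ↦ ((Λ s - (s * m + |s| * δ) : ℝ) : EReal)) (𝓝[>] 0)
      (𝓝 ((Λ s - s * m : ℝ) : EReal)) := by
    refine (Continuous.tendsto' ?_ 0 _ (by simp)).mono_left nhdsWithin_le_nhds
    exact continuous_coe_real_ereal.comp (by fun_prop)
  refine le_of_tendsto hlim ?_
  filter_upwards [Ioo_mem_nhdsGT (sub_pos.2 hx)] with δ hδ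
  refine (sub_le_expGrowthInf_measure_gt hS hupper hlower hm hδ.1).trans
    (expGrowthInf_monotone fun n ↦ measure_mono fun ω hω ↦ lt_of_le_of_lt (b := n * (m - δ)) ?_ hω)
  have : x ≤ m - δ := by linarith [hδ.2]
  gcongr

end GartnerEllis

section Criterion

variable {x₀ : ℝ} {I : ℝ → ℝ≥0∞} {M : ℕ → Ω → ℝ}

lemma measure_mem_le_add_of_subset_union {X : Ω → ℝ} {A B C : Set ℝ} (h : A ⊆ B ∪ C) :
    P {ω | X ω ∈ A} ≤ P {ω | X ω ∈ B} + P {ω | X ω ∈ C} :=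
  (measure_mono fun ω hω ↦ h (a := X ω) hω).trans (measure_union_le (X ⁻¹' B) (X ⁻¹' C))

lemma neg_le_expGrowthInf_measure_mem (hmono : ∀ x ≠ x₀, ∀ t > 1, I x < I (x₀ + t * (x - x₀)))
    (hlower : ∀ x ≠ x₀, -(I x : EReal) ≤ expGrowthInf fun n ↦ P {ω | M n ω ∈ awayTail x₀ x})
    (hupper : ∀ x, expGrowthSup (fun n ↦ P {ω | M n ω ∈ awayTail x₀ x}) ≤ -(I x : EReal))
    {A : Set ℝ} {x : ℝ} (hA : A ∈ 𝓝 x) (hx : x ≠ x₀) :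
    -(I x : EReal) ≤ expGrowthInf fun n ↦ P {ω | M n ω ∈ A} := by
  obtain ⟨ε, hε, hball⟩ := Metric.mem_nhds_iff.1 hA
  obtain ⟨t, ht, hcover⟩ := exists_awayTail_subset_ball_union hx hε
  refine le_expGrowthInf_of_le_add (fun n ↦ measure_mem_le_add_of_subset_union
    (hcover.trans (union_subset_union_left _ hball))) (hlower x hx) ((hupper _).trans_lt ?_)
  exact EReal.neg_lt_neg_iff.2 (EReal.coe_ennreal_lt_coe_ennreal_iff.2 (hmono x hx t ht))

lemma zero_le_expGrowthInf_measure_mem [IsProbabilityMeasure P] (hI : ∀ x ≠ x₀, 0 < I x)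
    (hupper : ∀ x, expGrowthSup (fun n ↦ P {ω | M n ω ∈ awayTail x₀ x}) ≤ -(I x : EReal))
    {A : Set ℝ} (hA : A ∈ 𝓝 x₀) : 0 ≤ expGrowthInf fun n ↦ P {ω | M n ω ∈ A} := by
  obtain ⟨ε, hε, hball⟩ := Metric.mem_nhds_iff.1 hA
  have htail : ∀ x ≠ x₀, expGrowthSup (fun n ↦ P {ω | M n ω ∈ awayTail x₀ x}) < 0 := by
    intro x hx
    refine (hupper x).trans_lt ?_
    simpa using hI x hx
  have hcover : (fun _ ↦ 1 : ℕ → ℝ≥0∞) ≤ (fun n ↦ P {ω | M n ω ∈ A}) +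
      ((fun n ↦ P {ω | M n ω ∈ awayTail x₀ (x₀ + ε)}) +
        fun n ↦ P {ω | M n ω ∈ awayTail x₀ (x₀ - ε)}) := by
    intro n
    calc 1 = P {ω | M n ω ∈ univ} := by simp
      _ ≤ P {ω | M n ω ∈ A} + P {ω | M n ω ∈ (Metric.ball x₀ ε)ᶜ} :=
        measure_mem_le_add_of_subset_union
          ((union_compl_self _).ge.trans (union_subset_union_left _ hball))
      _ ≤ _ := add_le_add_right
        (measure_mem_le_add_of_subset_union (compl_ball_subset_awayTail x₀ hε)) _
  refine le_expGrowthInf_of_le_add hcover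
    (expGrowthInf_const one_ne_zero ENNReal.one_ne_top).ge ?_
  rw [expGrowthSup_add]
  exact max_lt (htail _ (by simp [hε.ne'])) (htail _ (by simp [hε.ne']))

lemma expGrowthSup_measure_mem_le
    (hupper : ∀ x, expGrowthSup (fun n ↦ P {ω | M n ω ∈ awayTail x₀ x}) ≤ -(I x : EReal))
    (A : Set ℝ) :
    expGrowthSup (fun n ↦ P {ω | M n ω ∈ A}) ≤ -(⨅ x ∈ closure A, (I x : EReal)) := by
  have hside : ∀ s ⊆ A, s ⊆ Ici x₀ ∨ s ⊆ Iic x₀ →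
      expGrowthSup (fun n ↦ P {ω | M n ω ∈ s}) ≤ -(⨅ x ∈ closure A, (I x : EReal)) := by
    intro s hsA hs
    rcases s.eq_empty_or_nonempty with rfl | hne
    · simp only [mem_empty_iff_false, ofPred_false, measure_empty]
      exact expGrowthSup_zero.trans_le bot_le
    obtain ⟨y, hy, hsub⟩ := exists_mem_closure_subset_awayTail hne hs
    calc expGrowthSup (fun n ↦ P {ω | M n ω ∈ s})
        ≤ expGrowthSup (fun n ↦ P {ω | M n ω ∈ awayTail x₀ y}) :=
          expGrowthSup_monotone fun n ↦ measure_mono fun ω hω ↦ hsub hω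
      _ ≤ -(I y : EReal) := hupper y
      _ ≤ -(⨅ x ∈ closure A, (I x : EReal)) :=
          EReal.neg_le_neg_iff.2 (iInf₂_le y (closure_mono hsA hy))
  calc expGrowthSup (fun n ↦ P {ω | M n ω ∈ A})
      ≤ expGrowthSup ((fun n ↦ P {ω | M n ω ∈ A ∩ Ici x₀}) +
          fun n ↦ P {ω | M n ω ∈ A ∩ Iic x₀}) :=
        expGrowthSup_monotone fun n ↦ measure_mem_le_add_of_subset_union (by
          rw [← inter_union_distrib_left, union_comm, Iic_union_Ici, inter_univ])
    _ ≤ -(⨅ x ∈ closure A, (I x : EReal)) := by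
        rw [expGrowthSup_add]
        exact max_le (hside _ inter_subset_left (.inl inter_subset_right))
          (hside _ inter_subset_left (.inr inter_subset_right))

lemma coe_inv_natCast_mul_log (n : ℕ) (p : ℝ≥0∞) :
    (((n : ℝ)⁻¹ : ℝ) : EReal) * ENNReal.log p = ENNReal.log p / n := by
  rw [EReal.div_eq_inv_mul, EReal.coe_inv, EReal.coe_natCast]

theorem satisfiesLDP_of_awayTail [IsProbabilityMeasure P] (hM : ∀ n, AEMeasurable (M n) P)
    (hI : LowerSemicontinuous I) (hI₀ : I x₀ = 0)
    (hmono : ∀ x ≠ x₀, ∀ t > 1, I x < I (x₀ + t * (x - x₀)))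
    (hlower : ∀ x ≠ x₀, -(I x : EReal) ≤ expGrowthInf fun n ↦ P {ω | M n ω ∈ awayTail x₀ x})
    (hupper : ∀ x, expGrowthSup (fun n ↦ P {ω | M n ω ∈ awayTail x₀ x}) ≤ -(I x : EReal)) :
    SatisfiesLDP P M (fun n ↦ n) I where
  aemeasurable := hM
  speed_tendsto := tendsto_natCast_atTop_atTop
  lowerSemicontinuous := hI
  lower_bound A _ := by
    simp_rw [coe_inv_natCast_mul_log]
    refine EReal.neg_le_of_neg_le (le_iInf₂ fun x hx ↦ EReal.neg_le_of_neg_le ?_)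
    rw [mem_interior_iff_mem_nhds] at hx
    rcases eq_or_ne x x₀ with rfl | hne
    · have hpos : ∀ y ≠ x, 0 < I y := by
        intro y hy
        have := hmono (x + (y - x) / 2) (by simpa [sub_eq_zero] using hy) 2 one_lt_two
        rw [show x + 2 * (x + (y - x) / 2 - x) = y by ring] at this
        exact pos_of_gt this
      rw [hI₀, EReal.coe_ennreal_zero, neg_zero]
      exact zero_le_expGrowthInf_measure_mem hpos hupper hx
    · exact neg_le_expGrowthInf_measure_mem hmono hlower hupper hx hne
  upper_bound A _ := by
    simp_rw [coe_inv_natCast_mul_log]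
    exact expGrowthSup_measure_mem_le hupper A

lemma SatisfiesLDP.congr_ae {S : Type*} [TopologicalSpace S] [MeasurableSpace S]
    {X Y : ℕ → Ω → S} {r : ℕ → ℝ} {J : S → ℝ≥0∞} (hX : SatisfiesLDP P X r J)
    (hXY : ∀ n, X n =ᵐ[P] Y n) : SatisfiesLDP P Y r J := by
  have hmeas : ∀ n (A : Set S), P {ω | Y n ω ∈ A} = P {ω | X n ω ∈ A} := fun n A ↦
    measure_congr (eventuallyEq_set.2 ((hXY n).mono fun ω hω ↦ by
      simp only [mem_ofPred_eq, hω]))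
  refine ⟨fun n ↦ (hX.aemeasurable n).congr (hXY n), hX.speed_tendsto, hX.lowerSemicontinuous,
    fun A hA ↦ ?_, fun A hA ↦ ?_⟩ <;> simp_rw [hmeas]
  exacts [hX.lower_bound A hA, hX.upper_bound A hA]

lemma isGoodRateFunction_of_tendsto_cocompact {S : Type*} [TopologicalSpace S] {J : S → ℝ≥0∞}
    (hJ : LowerSemicontinuous J) (hlim : Tendsto J (cocompact S) (𝓝 ⊤)) :
    IsGoodRateFunction J where
  lowerSemicontinuous := hJ
  isCompact_sublevel c := by
    obtain ⟨K, hK, hsub⟩ :=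
      mem_cocompact'.1 (hlim.eventually (lt_mem_nhds (ENNReal.coe_lt_top (r := c))))
    refine hK.of_isClosed_subset (hJ.isClosed_preimage _) fun x (hx : J x ≤ c) ↦ hsub ?_
    simpa using hx

end Criterion

end LargeDeviations

section SlopeRate

/-- The rate function `½ log (1 + ((x - x₀) / κ) ^ 2)` of the empirical regression slope of
`x₀ ξ + κ η` on `ξ`, for independent standard normal `ξ` and `η`. -/
noncomputable def slopeRate (x₀ κ x : ℝ) : ℝ≥0∞ :=
  ENNReal.ofReal (1 / 2 * Real.log (1 + ((x - x₀) / κ) ^ 2))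

lemma coe_slopeRate (x₀ κ x : ℝ) :
    (slopeRate x₀ κ x : EReal) = (1 / 2 * Real.log (1 + ((x - x₀) / κ) ^ 2) : ℝ) := by
  rw [slopeRate, EReal.coe_ennreal_ofReal, max_eq_left]
  have := Real.log_nonneg (x := 1 + ((x - x₀) / κ) ^ 2) (by nlinarith [sq_nonneg ((x - x₀) / κ)])
  positivity

lemma slopeRate_self (x₀ κ : ℝ) : slopeRate x₀ κ x₀ = 0 := by
  simp [slopeRate]

lemma continuous_slopeRate (x₀ κ : ℝ) : Continuous (slopeRate x₀ κ) := by
  unfold slopeRate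
  refine ENNReal.continuous_ofReal.comp (continuous_const.mul (Continuous.log (by fun_prop) ?_))
  intro x
  positivity

variable {x₀ κ : ℝ}

lemma slopeRate_lt_slopeRate_ray (hκ : κ ≠ 0) {x : ℝ} (hx : x ≠ x₀) {t : ℝ} (ht : 1 < t) :
    slopeRate x₀ κ x < slopeRate x₀ κ (x₀ + t * (x - x₀)) := by
  have hc : 0 < ((x - x₀) / κ) ^ 2 := by
    have := sub_ne_zero.2 hx
    positivity
  have hlt : 1 + ((x - x₀) / κ) ^ 2 < 1 + ((x₀ + t * (x - x₀) - x₀) / κ) ^ 2 := by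
    rw [add_sub_cancel_left, mul_div_assoc, mul_pow]
    exact add_lt_add_right (lt_mul_of_one_lt_left hc (one_lt_pow₀ ht two_ne_zero)) 1
  rw [slopeRate, slopeRate, ENNReal.ofReal_lt_ofReal_iff (by
    have := Real.log_pos (lt_of_le_of_lt (by linarith) hlt); positivity)]
  gcongr

lemma isGoodRateFunction_slopeRate (hκ : κ ≠ 0) : IsGoodRateFunction (slopeRate x₀ κ) := by
  refine isGoodRateFunction_of_tendsto_cocompact (continuous_slopeRate x₀ κ).lowerSemicontinuous ?_
  have hnorm : Tendsto (fun x : ℝ ↦ ‖(x - x₀) / κ‖) (cocompact ℝ) atTop := by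
    have hsub := tendsto_norm_cocompact_atTop.comp
      (Homeomorph.subRight x₀).isClosedEmbedding.tendsto_cocompact
    simp_rw [norm_div]
    exact hsub.atTop_div_const (norm_pos_iff.2 hκ)
  refine ENNReal.tendsto_ofReal_atTop.comp (Tendsto.const_mul_atTop one_half_pos
    (Real.tendsto_log_atTop.comp (tendsto_atTop_add_const_left _ _ ?_)))
  exact ((tendsto_pow_atTop two_ne_zero).comp hnorm).congr fun x ↦ by
    rw [Function.comp_apply, Real.norm_eq_abs, sq_abs]

end SlopeRate

section GaussianQuadratic

lemma gaussianPDFReal_mul_exp_quadratic {w : ℝ} (hw : w < 1) (t y : ℝ) :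
    gaussianPDFReal 0 1 y * Real.exp (w * y ^ 2 / 2 + t * y) =
      (√(1 - w))⁻¹ * Real.exp (t ^ 2 / (2 * (1 - w))) *
        gaussianPDFReal (t / (1 - w)) ((1 - w)⁻¹).toNNReal y := by
  have hw' : 0 < 1 - w := by linarith
  have hcomplete : Real.exp (-y ^ 2 / 2) * Real.exp (w * y ^ 2 / 2 + t * y) =
      Real.exp (t ^ 2 / (2 * (1 - w))) *
        Real.exp (-(y - t / (1 - w)) ^ 2 / (2 * (1 - w)⁻¹)) := by
    rw [← Real.exp_add, ← Real.exp_add]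
    congr 1
    field_simp
    ring
  have hsqrt : √(2 * Real.pi * (1 - w)⁻¹) = √(2 * Real.pi) * (√(1 - w))⁻¹ := by
    rw [Real.sqrt_mul (by positivity), Real.sqrt_inv]
  simp only [gaussianPDFReal, NNReal.coe_one, Real.coe_toNNReal _ (inv_pos.2 hw').le, mul_one,
    sub_zero]
  rw [mul_assoc, hcomplete, hsqrt]
  have := Real.sqrt_pos.2 hw'
  field_simp

lemma lintegral_exp_quadratic_gaussianReal {w : ℝ} (hw : w < 1) (t : ℝ) :
    ∫⁻ y, ENNReal.ofReal (Real.exp (w * y ^ 2 / 2 + t * y)) ∂(gaussianReal 0 1) =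
      ENNReal.ofReal ((√(1 - w))⁻¹ * Real.exp (t ^ 2 / (2 * (1 - w)))) := by
  have hv : ((1 - w)⁻¹).toNNReal ≠ 0 :=
    (Real.toNNReal_pos.2 (inv_pos.2 (sub_pos.2 hw))).ne'
  rw [gaussianReal_of_var_ne_zero _ one_ne_zero,
    lintegral_withDensity_eq_lintegral_mul _ (measurable_gaussianPDF _ _) (by fun_prop)]
  simp_rw [Pi.mul_apply, gaussianPDF, ← ENNReal.ofReal_mul (gaussianPDFReal_nonneg _ _ _),
    gaussianPDFReal_mul_exp_quadratic hw]
  have hnonneg : 0 ≤ (√(1 - w))⁻¹ * Real.exp (t ^ 2 / (2 * (1 - w))) := by positivity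
  simp_rw [ENNReal.ofReal_mul hnonneg]
  rw [lintegral_const_mul _ (by fun_prop), lintegral_gaussianPDFReal_eq_one _ hv, mul_one]

/-- Half of the quadratic form on `ℝ²` with symmetric matrix `(u, v; v, w)`. -/
noncomputable def halfQuadratic (u v w : ℝ) (p : ℝ × ℝ) : ℝ :=
  (u * p.1 ^ 2 + 2 * v * (p.1 * p.2) + w * p.2 ^ 2) / 2

@[fun_prop]
lemma measurable_halfQuadratic (u v w : ℝ) : Measurable (halfQuadratic u v w) := by
  unfold halfQuadratic
  fun_prop

lemma lintegral_exp_halfQuadratic {u v w : ℝ} (hw : w < 1) (hdet : v ^ 2 < (1 - u) * (1 - w)) :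
    ∫⁻ p, ENNReal.ofReal (Real.exp (halfQuadratic u v w p))
      ∂((gaussianReal 0 1).prod (gaussianReal 0 1)) =
      ENNReal.ofReal (√((1 - u) * (1 - w) - v ^ 2))⁻¹ := by
  have hw' : 0 < 1 - w := by linarith
  set u' := u + v ^ 2 / (1 - w) with hu'
  have hu'_lt : u' < 1 := by
    have : v ^ 2 / (1 - w) < 1 - u := by rwa [div_lt_iff₀ hw']
    linarith
  have hinner : ∀ x : ℝ, ∫⁻ y, ENNReal.ofReal (Real.exp (halfQuadratic u v w (x, y)))
      ∂(gaussianReal 0 1) = ENNReal.ofReal (√(1 - w))⁻¹ *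
        ENNReal.ofReal (Real.exp (u' * x ^ 2 / 2 + 0 * x)) := by
    intro x
    have hsplit : ∀ y : ℝ, halfQuadratic u v w (x, y) =
        u * x ^ 2 / 2 + (w * y ^ 2 / 2 + v * x * y) := fun y ↦ by
      simp only [halfQuadratic]; ring
    simp_rw [hsplit, Real.exp_add _ (_ + _), ENNReal.ofReal_mul (Real.exp_pos _).le]
    rw [lintegral_const_mul _ (by fun_prop), lintegral_exp_quadratic_gaussianReal hw,
      ← ENNReal.ofReal_mul (Real.exp_pos _).le, ← ENNReal.ofReal_mul (by positivity),
      mul_left_comm, ← Real.exp_add]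
    congr 3
    rw [hu']
    field_simp
    ring
  have hfactor : (1 - u) * (1 - w) - v ^ 2 = (1 - w) * (1 - u') := by
    rw [hu']
    field_simp
    ring
  rw [lintegral_prod _ (by fun_prop)]
  simp_rw [hinner]
  rw [lintegral_const_mul _ (by fun_prop), lintegral_exp_quadratic_gaussianReal hu'_lt,
    ← ENNReal.ofReal_mul (by positivity), hfactor, Real.sqrt_mul hw'.le, mul_inv]
  simp

end GaussianQuadratic

section StdNormalSample

variable {ι Ω : Type*} [Fintype ι] [MeasurableSpace Ω] {P : Measure Ω}

/-- The law of a family, indexed by `ι`, of independent pairs of independent standard normal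
variables. -/
noncomputable def stdNormalPairs (ι : Type*) [Fintype ι] : Measure (ι → ℝ × ℝ) :=
  Measure.pi fun _ ↦ (gaussianReal 0 1).prod (gaussianReal 0 1)

instance : IsProbabilityMeasure (stdNormalPairs ι) := by
  unfold stdNormalPairs
  infer_instance

lemma hasLaw_stdNormalPairs_of_indepFun {X Y : Ω → ι → ℝ}
    (hX : HasLaw X (Measure.pi fun _ ↦ gaussianReal 0 1) P)
    (hY : HasLaw Y (Measure.pi fun _ ↦ gaussianReal 0 1) P) (hXY : IndepFun X Y P) :
    HasLaw (fun ω i ↦ (X ω i, Y ω i)) (stdNormalPairs ι) P := by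
  have := hX.isProbabilityMeasure
  exact (measurePreserving_arrowProdEquivProdArrow ℝ ℝ ι _ _).symm.comp_hasLaw
    (hXY.hasLaw_prod hX hY)

/-- With `(ξ₁, η₁)` for the new pair, `(ξ, ρ * ξ + √(1 - ρ ^ 2) * η)` is
`(ρ * ξ₁ + √(1 - ρ ^ 2) * η₁, ξ₁)`: each of two correlated variables can serve as the regressor. -/
lemma hasLaw_stdNormalPairs_swap_rotation {Z : Ω → ι → ℝ × ℝ}
    (hZ : HasLaw Z (stdNormalPairs ι) P) {ρ : ℝ} (hρ : ρ ∈ Icc (-1) 1) :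
    HasLaw (fun ω i ↦ (ρ * (Z ω i).1 + √(1 - ρ ^ 2) * (Z ω i).2,
      √(1 - ρ ^ 2) * (Z ω i).1 - ρ * (Z ω i).2)) (stdNormalPairs ι) P := by
  have hrot : MeasurePreserving (ContinuousLinearMap.rotation (E := ℝ) (Real.arcsin ρ))
      ((gaussianReal 0 1).prod (gaussianReal 0 1)) ((gaussianReal 0 1).prod (gaussianReal 0 1)) :=
    ⟨by fun_prop, IsGaussian.map_rotation_eq_self (by simp) _⟩
  have hpi := (measurePreserving_pi _ _ fun _ : ι ↦
    hrot.comp Measure.measurePreserving_swap).comp_hasLaw hZ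
  refine hpi.congr (.of_forall fun ω ↦ funext fun i ↦ ?_)
  simp only [Function.comp_apply, ContinuousLinearMap.rotation_apply, Real.cos_arcsin,
    Real.sin_arcsin hρ.1 hρ.2, Prod.fst_swap, Prod.snd_swap, smul_eq_mul, neg_mul, Prod.mk.injEq]
  constructor <;> ring

lemma lintegral_prod_stdNormalPairs {F : ℝ × ℝ → ℝ≥0∞} (hF : Measurable F) :
    ∫⁻ z, ∏ i, F (z i) ∂(stdNormalPairs ι) =
      (∫⁻ p, F p ∂((gaussianReal 0 1).prod (gaussianReal 0 1))) ^ Fintype.card ι := by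
  have hind : iIndepFun (fun (i : ι) (z : ι → ℝ × ℝ) ↦ F (z i)) (stdNormalPairs ι) :=
    iIndepFun_pi (X := fun _ ↦ F) fun _ ↦ hF.aemeasurable
  have heval : ∀ i, ∫⁻ z, F (z i) ∂(stdNormalPairs ι) =
      ∫⁻ p, F p ∂((gaussianReal 0 1).prod (gaussianReal 0 1)) := fun i ↦
    (measurePreserving_eval _ i).lintegral_comp hF
  rw [lintegral_prod_eq_prod_lintegral_of_indepFun _ _ hind fun i ↦ by fun_prop]
  simp_rw [heval, Finset.prod_const, Finset.card_univ]

lemma lintegral_exp_sum_halfQuadratic {Z : Ω → ι → ℝ × ℝ} (hZ : HasLaw Z (stdNormalPairs ι) P)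
    {u v w : ℝ} (hw : w < 1) (hdet : v ^ 2 < (1 - u) * (1 - w)) :
    ∫⁻ ω, ENNReal.ofReal (Real.exp (∑ i, halfQuadratic u v w (Z ω i))) ∂P =
      ENNReal.ofReal (√((1 - u) * (1 - w) - v ^ 2))⁻¹ ^ Fintype.card ι := by
  simp_rw [Real.exp_sum, ENNReal.ofReal_prod_of_nonneg fun _ _ ↦ (Real.exp_pos _).le]
  rw [← lintegral_exp_halfQuadratic hw hdet, ← lintegral_prod_stdNormalPairs (by fun_prop)]
  exact hZ.lintegral_comp (f := fun z : ι → ℝ × ℝ ↦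
    ∏ i, ENNReal.ofReal (Real.exp (halfQuadratic u v w (z i))))
    (Measurable.aemeasurable (by fun_prop))

end StdNormalSample

section RegressionSlope

variable {ι : Type*} [Fintype ι]

/-- The least-squares slope of the regression through the origin of the second coordinates of the
points `p i` on the first ones; it is `0` if all first coordinates vanish. -/
noncomputable def regressionSlope (p : ι → ℝ × ℝ) : ℝ :=
  (∑ i, (p i).1 * (p i).2) / ∑ i, (p i).1 ^ 2

@[fun_prop]
lemma measurable_regressionSlope : Measurable (regressionSlope (ι := ι)) := by
  unfold regressionSlope
  fun_prop

lemma regressionSlope_mul_sum_sq (p : ι → ℝ × ℝ) :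
    regressionSlope p * ∑ i, (p i).1 ^ 2 = ∑ i, (p i).1 * (p i).2 := by
  rcases eq_or_ne (∑ i, (p i).1 ^ 2) 0 with h | h
  · have hzero : ∀ i, (p i).1 = 0 := fun i ↦ pow_eq_zero_iff two_ne_zero |>.1
      ((Finset.sum_eq_zero_iff_of_nonneg fun i _ ↦ sq_nonneg (p i).1).1 h i (Finset.mem_univ i))
    simp [hzero]
  · rw [regressionSlope, div_mul_cancel₀ _ h]

lemma regressionSlope_const_mul {s : ℝ} (hs : s ≠ 0) (p : ι → ℝ × ℝ) :
    regressionSlope (fun i ↦ (s * (p i).1, s * (p i).2)) = regressionSlope p := by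
  simp only [regressionSlope, mul_mul_mul_comm s, mul_pow, ← Finset.mul_sum, ← sq]
  rw [mul_div_mul_left _ _ (pow_ne_zero 2 hs)]

/-- The linear response `x₀ * ξ + κ * η` to the regressor `ξ`, paired with `ξ` itself, for
`p = (ξ, η)`. -/
def shear (x₀ κ : ℝ) (p : ℝ × ℝ) : ℝ × ℝ :=
  (p.1, x₀ * p.1 + κ * p.2)

@[fun_prop]
lemma measurable_shear (x₀ κ : ℝ) : Measurable (shear x₀ κ) := by
  unfold shear
  fun_prop

/-- The summands of a statistic whose sign tells on which side of `x₀ + κ * c` the regression slope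
of the points `shear x₀ κ (p i)` lies; written as a quadratic form, the score of `p` is
`c * (p.1 * (p.2 - c * p.1))`. -/
noncomputable def slopeScore (c : ℝ) : ℝ × ℝ → ℝ :=
  halfQuadratic (-(2 * c ^ 2)) c 0

variable {x₀ κ : ℝ}

lemma regressionSlope_shear_sub_mul (hκ : κ ≠ 0) (q : ι → ℝ × ℝ) (x : ℝ) :
    (x - x₀) * (regressionSlope (fun i ↦ shear x₀ κ (q i)) - x) * ∑ i, (q i).1 ^ 2 =
      κ ^ 2 * ∑ i, slopeScore ((x - x₀) / κ) (q i) := by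
  have hslope : regressionSlope (fun i ↦ shear x₀ κ (q i)) * ∑ i, (q i).1 ^ 2 =
      ∑ i, (q i).1 * (x₀ * (q i).1 + κ * (q i).2) :=
    regressionSlope_mul_sum_sq fun i ↦ shear x₀ κ (q i)
  rw [mul_assoc, sub_mul (regressionSlope _), hslope, Finset.mul_sum, ← Finset.sum_sub_distrib,
    Finset.mul_sum, Finset.mul_sum]
  refine Finset.sum_congr rfl fun i _ ↦ ?_
  simp only [slopeScore, halfQuadratic]
  field_simp
  ring

lemma sum_slopeScore_nonneg_of_mem_awayTail (hκ : κ ≠ 0) {q : ι → ℝ × ℝ} {x : ℝ}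
    (h : regressionSlope (fun i ↦ shear x₀ κ (q i)) ∈ awayTail x₀ x) :
    0 ≤ ∑ i, slopeScore ((x - x₀) / κ) (q i) := by
  refine nonneg_of_mul_nonneg_right (a := κ ^ 2) ?_ (by positivity)
  rw [← regressionSlope_shear_sub_mul hκ]
  exact mul_nonneg h (Finset.sum_nonneg fun i _ ↦ sq_nonneg _)

lemma mem_awayTail_of_sum_slopeScore_pos (hκ : κ ≠ 0) {q : ι → ℝ × ℝ} {x : ℝ}
    (h : 0 < ∑ i, slopeScore ((x - x₀) / κ) (q i)) :
    regressionSlope (fun i ↦ shear x₀ κ (q i)) ∈ awayTail x₀ x := by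
  have hpos : 0 < κ ^ 2 * ∑ i, slopeScore ((x - x₀) / κ) (q i) := by positivity
  rw [← regressionSlope_shear_sub_mul hκ] at hpos
  exact (pos_of_mul_pos_left hpos (Finset.sum_nonneg fun i _ ↦ sq_nonneg _)).le

end RegressionSlope

section Perturbation

/-- Each product `p.1 * e.1`, …, of a perturbation `e` with `p` is split by
`2 * (x * y) ≤ δ * x ^ 2 + y ^ 2 / δ`. -/
lemma exists_abs_halfQuadratic_add_sub_le (u v w : ℝ) {δ : ℝ} (hδ : 0 < δ) :
    ∃ C ≥ 0, ∀ p e : ℝ × ℝ, |halfQuadratic u v w (p + e) - halfQuadratic u v w p| ≤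
      δ * (p.1 ^ 2 + p.2 ^ 2) + C * (e.1 ^ 2 + e.2 ^ 2) := by
  set M := u ^ 2 + 2 * v ^ 2 + w ^ 2
  refine ⟨M / (4 * δ) + (M + 1) / 4, by positivity, fun p e ↦ ?_⟩
  set y₁ := u * e.1 + v * e.2 with hy₁
  set y₂ := v * e.1 + w * e.2 with hy₂
  have hpolar : halfQuadratic u v w (p + e) - halfQuadratic u v w p =
      (p.1 * y₁ + p.2 * y₂) + (e.1 * y₁ + e.2 * y₂) / 2 := by
    simp only [halfQuadratic, Prod.fst_add, Prod.snd_add, hy₁, hy₂]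
    ring
  have hy : y₁ ^ 2 + y₂ ^ 2 ≤ M * (e.1 ^ 2 + e.2 ^ 2) := by
    have h₁ : y₁ ^ 2 = (u ^ 2 + v ^ 2) * (e.1 ^ 2 + e.2 ^ 2) - (u * e.2 - v * e.1) ^ 2 := by ring
    have h₂ : y₂ ^ 2 = (v ^ 2 + w ^ 2) * (e.1 ^ 2 + e.2 ^ 2) - (v * e.2 - w * e.1) ^ 2 := by ring
    simp only [M]
    nlinarith [h₁, h₂, sq_nonneg (u * e.2 - v * e.1), sq_nonneg (v * e.2 - w * e.1)]
  have hyoung : ∀ {ε : ℝ}, 0 < ε → ∀ q : ℝ × ℝ, |q.1 * y₁ + q.2 * y₂| ≤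
      ε * (q.1 ^ 2 + q.2 ^ 2) + M / (4 * ε) * (e.1 ^ 2 + e.2 ^ 2) := by
    intro ε hε q
    have hdiv : (y₁ ^ 2 + y₂ ^ 2) / (4 * ε) ≤ M / (4 * ε) * (e.1 ^ 2 + e.2 ^ 2) := by
      rw [div_mul_eq_mul_div]
      gcongr
    refine le_trans (abs_le.2 ⟨?_, ?_⟩) (add_le_add_right hdiv _) <;> field_simp
    · nlinarith [sq_nonneg (2 * ε * q.1 + y₁), sq_nonneg (2 * ε * q.2 + y₂)]
    · nlinarith [sq_nonneg (2 * ε * q.1 - y₁), sq_nonneg (2 * ε * q.2 - y₂)]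
  have hp := hyoung hδ p
  have he := hyoung one_half_pos e
  rw [hpolar]
  refine (abs_add_le _ _).trans ?_
  rw [abs_div, abs_two]
  linarith

/-- The score `slopeScore c` with an additional term `δ * ‖p‖ ^ 2`, which for `δ > 0` (`δ < 0`)
dominates (is dominated by) the score of a perturbation of `p`, up to a constant. -/
noncomputable def slackScore (c δ : ℝ) : ℝ × ℝ → ℝ :=
  halfQuadratic (2 * (δ - c ^ 2)) c (2 * δ)

@[fun_prop]
lemma measurable_slackScore (c δ : ℝ) : Measurable (slackScore c δ) :=
  measurable_halfQuadratic _ _ _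

lemma slackScore_eq_slopeScore_add (c δ : ℝ) (p : ℝ × ℝ) :
    slackScore c δ p = slopeScore c p + δ * (p.1 ^ 2 + p.2 ^ 2) := by
  simp only [slackScore, slopeScore, halfQuadratic]
  ring

lemma exists_sum_slopeScore_add_bounds (c K : ℝ) {δ : ℝ} (hδ : 0 < δ) :
    ∃ C, ∀ (n : ℕ) (p e : Fin n → ℝ × ℝ), ∑ i, ((e i).1 ^ 2 + (e i).2 ^ 2) ≤ K →
      ∑ i, slackScore c (-δ) (p i) - C ≤ ∑ i, slopeScore c (p i + e i) ∧
      ∑ i, slopeScore c (p i + e i) ≤ ∑ i, slackScore c δ (p i) + C := by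
  obtain ⟨C, hC, hbound⟩ := exists_abs_halfQuadratic_add_sub_le (-(2 * c ^ 2)) c 0 hδ
  refine ⟨C * K, fun n p e he ↦ ?_⟩
  have hCe : ∑ i, C * ((e i).1 ^ 2 + (e i).2 ^ 2) ≤ C * K := by
    rw [← Finset.mul_sum]
    gcongr
  have hscore : ∀ i, |slopeScore c (p i + e i) - slopeScore c (p i)| ≤
      δ * ((p i).1 ^ 2 + (p i).2 ^ 2) + C * ((e i).1 ^ 2 + (e i).2 ^ 2) :=
    fun i ↦ hbound (p i) (e i)
  constructor
  · rw [sub_le_iff_le_add]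
    refine le_trans ?_ (add_le_add_right hCe _)
    rw [← Finset.sum_add_distrib]
    refine Finset.sum_le_sum fun i _ ↦ ?_
    rw [slackScore_eq_slopeScore_add]
    linarith [(abs_le.1 (hscore i)).1]
  · refine le_trans ?_ (add_le_add_right hCe _)
    rw [← Finset.sum_add_distrib]
    refine Finset.sum_le_sum fun i _ ↦ ?_
    rw [slackScore_eq_slopeScore_add]
    linarith [(abs_le.1 (hscore i)).2]

end Perturbation

section ScoreTails

open ExpGrowth

variable {Ω : Type*} [MeasurableSpace Ω] {P : Measure Ω}

/-- The exponential moments of the sum of `n` independent variables `s * slackScore c δ (ξ, η)`,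
for standard normal `ξ`, `η`, are the powers `slackDet c δ s ^ (-n / 2)` of this determinant. -/
def slackDet (c δ s : ℝ) : ℝ :=
  (1 - s * (2 * (δ - c ^ 2))) * (1 - s * (2 * δ)) - (s * c) ^ 2

/-- The slope in `s` of the determinant `slackDet c δ s`. -/
def slackDetSlope (c δ s : ℝ) : ℝ :=
  2 * c ^ 2 - 4 * δ + 2 * s * (4 * δ * (δ - c ^ 2) - c ^ 2)

@[fun_prop]
lemma continuous_slackDet (c : ℝ) : Continuous fun p : ℝ × ℝ ↦ slackDet c p.1 p.2 := by
  unfold slackDet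
  fun_prop

lemma hasDerivAt_slackDet (c δ s : ℝ) :
    HasDerivAt (slackDet c δ) (slackDetSlope c δ s) s := by
  have heq : slackDet c δ = fun s ↦
      1 + (2 * c ^ 2 - 4 * δ) * s + (4 * δ * (δ - c ^ 2) - c ^ 2) * s ^ 2 := by
    funext s
    simp only [slackDet]
    ring
  rw [heq]
  have hpoly := (((hasDerivAt_id' s).const_mul (2 * c ^ 2 - 4 * δ)).const_add 1).add
    ((hasDerivAt_pow 2 s).const_mul (4 * δ * (δ - c ^ 2) - c ^ 2))
  refine hpoly.congr_deriv ?_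
  rw [slackDetSlope]
  norm_num
  ring

@[fun_prop]
lemma continuous_slackDetSlope (c : ℝ) : Continuous fun p : ℝ × ℝ ↦ slackDetSlope c p.1 p.2 := by
  unfold slackDetSlope
  fun_prop

lemma slackDet_zero_one (c : ℝ) : slackDet c 0 1 = 1 + c ^ 2 := by
  rw [slackDet]
  ring

lemma slackDetSlope_zero (c s : ℝ) : slackDetSlope c 0 s = 2 * c ^ 2 * (1 - s) := by
  rw [slackDetSlope]
  ring

lemma slackDet_zero_pos (c : ℝ) {s : ℝ} (hs : s ∈ Icc 0 2) : 0 < slackDet c 0 s := by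
  have hexpand : slackDet c 0 s = 1 + c ^ 2 * (s * (2 - s)) := by rw [slackDet]; ring
  have := mul_nonneg hs.1 (sub_nonneg.2 hs.2)
  rw [hexpand]
  positivity

/-- The limiting logarithmic moment generating function of the sums of `slackScore c δ`. -/
noncomputable def slackPressure (c δ s : ℝ) : ℝ :=
  -(1 / 2 * Real.log (slackDet c δ s))

lemma hasDerivAt_slackPressure {c δ s : ℝ} (hdet : 0 < slackDet c δ s) :
    HasDerivAt (slackPressure c δ) (-(slackDetSlope c δ s / (2 * slackDet c δ s))) s := by
  refine (((hasDerivAt_slackDet c δ s).log hdet.ne').const_mul (1 / 2)).neg.congr_deriv ?_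
  field_simp

/-- The logarithmic cost of moving the mean of `slackScore c δ` to its value under the exponential
tilt `s`, that is, minus the Legendre transform of `slackPressure c δ` at its slope in `s`. -/
noncomputable def slackEntropy (c δ s : ℝ) : ℝ :=
  slackPressure c δ s + s * (slackDetSlope c δ s / (2 * slackDet c δ s))

lemma continuousAt_slackEntropy {c x : ℝ} {f g : ℝ → ℝ} (hf : ContinuousAt f x)
    (hg : ContinuousAt g x) (hdet : 0 < slackDet c (f x) (g x)) :
    ContinuousAt (fun t ↦ slackEntropy c (f t) (g t)) x := by
  have hD : ContinuousAt (fun t ↦ slackDet c (f t) (g t)) x := by fun_prop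
  have hD' : ContinuousAt (fun t ↦ slackDetSlope c (f t) (g t)) x := by fun_prop
  exact ((hD.log hdet.ne').const_mul (1 / 2)).neg.add
    (hg.mul (hD'.div (hD.const_mul 2) (by positivity)))

lemma slackEntropy_zero_one (c : ℝ) : slackEntropy c 0 1 = -(1 / 2 * Real.log (1 + c ^ 2)) := by
  rw [slackEntropy, slackPressure, slackDet_zero_one, slackDetSlope_zero, sub_self, mul_zero,
    zero_div, mul_zero, add_zero]

lemma lintegral_exp_mul_sum_slackScore {ι : Type*} [Fintype ι] {Z : Ω → ι → ℝ × ℝ}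
    (hZ : HasLaw Z (stdNormalPairs ι) P) {c δ s : ℝ} (hs : s * (2 * δ) < 1)
    (hdet : 0 < slackDet c δ s) :
    ∫⁻ ω, ENNReal.ofReal (Real.exp (s * ∑ i, slackScore c δ (Z ω i))) ∂P =
      ENNReal.ofReal (Real.exp (slackPressure c δ s)) ^ Fintype.card ι := by
  have hscale : ∀ p, s * slackScore c δ p =
      halfQuadratic (s * (2 * (δ - c ^ 2))) (s * c) (s * (2 * δ)) p := fun p ↦ by
    simp only [slackScore, halfQuadratic]
    ring
  have hexp : Real.exp (slackPressure c δ s) = (√(slackDet c δ s))⁻¹ := by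
    rw [slackPressure, Real.exp_neg, one_div_mul_eq_div, ← Real.log_sqrt hdet.le,
      Real.exp_log (Real.sqrt_pos.2 hdet)]
  simp_rw [Finset.mul_sum, hscale]
  rw [hexp, lintegral_exp_sum_halfQuadratic hZ hs (sub_pos.1 hdet), slackDet]

variable {Z E : ∀ n, Ω → Fin n → ℝ × ℝ} {K : ℝ}

lemma expGrowthSup_lintegral_exp_mul_sum_slackScore
    (hZ : ∀ n, HasLaw (Z n) (stdNormalPairs (Fin n)) P) {c δ s : ℝ} (hs : s * (2 * δ) < 1)
    (hdet : 0 < slackDet c δ s) :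
    expGrowthSup (fun n ↦
      ∫⁻ ω, ENNReal.ofReal (Real.exp (s * ∑ i, slackScore c δ (Z n ω i))) ∂P) =
      slackPressure c δ s := by
  simp_rw [lintegral_exp_mul_sum_slackScore (hZ _) hs hdet, Fintype.card_fin, expGrowthSup_pow,
    ENNReal.log_ofReal_of_pos (Real.exp_pos _), Real.log_exp]

lemma expGrowthInf_lintegral_exp_mul_sum_slackScore
    (hZ : ∀ n, HasLaw (Z n) (stdNormalPairs (Fin n)) P) {c δ s : ℝ} (hs : s * (2 * δ) < 1)
    (hdet : 0 < slackDet c δ s) :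
    expGrowthInf (fun n ↦
      ∫⁻ ω, ENNReal.ofReal (Real.exp (s * ∑ i, slackScore c δ (Z n ω i))) ∂P) =
      slackPressure c δ s := by
  simp_rw [lintegral_exp_mul_sum_slackScore (hZ _) hs hdet, Fintype.card_fin, expGrowthInf_pow,
    ENNReal.log_ofReal_of_pos (Real.exp_pos _), Real.log_exp]

lemma aemeasurable_sum_slackScore {ι : Type*} [Fintype ι] {Z : Ω → ι → ℝ × ℝ}
    (hZ : AEMeasurable Z P) (c δ : ℝ) : AEMeasurable (fun ω ↦ ∑ i, slackScore c δ (Z ω i)) P :=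
  (show Measurable fun z : ι → ℝ × ℝ ↦ ∑ i, slackScore c δ (z i) by fun_prop).comp_aemeasurable hZ

lemma expGrowthSup_measure_sum_slopeScore_nonneg_le
    (hZ : ∀ n, HasLaw (Z n) (stdNormalPairs (Fin n)) P)
    (hE : ∀ n, ∀ᵐ ω ∂P, ∑ i, ((E n ω i).1 ^ 2 + (E n ω i).2 ^ 2) ≤ K) (c : ℝ) :
    expGrowthSup (fun n ↦ P {ω | 0 ≤ ∑ i, slopeScore c (Z n ω i + E n ω i)}) ≤
      (-(1 / 2 * Real.log (1 + c ^ 2)) : ℝ) := by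
  have hdet : ContinuousAt (fun δ ↦ slackDet c δ 1) 0 := by fun_prop
  have hdet₀ : 0 < slackDet c 0 1 := slackDet_zero_pos c (by norm_num)
  have hlim : Tendsto (fun δ ↦ (slackPressure c δ 1 : EReal)) (𝓝[>] 0)
      (𝓝 (-(1 / 2 * Real.log (1 + c ^ 2)) : ℝ)) := by
    rw [← slackDet_zero_one]
    exact EReal.tendsto_coe.2 (((hdet.log hdet₀.ne').const_mul (1 / 2)).neg.tendsto.mono_left
      nhdsWithin_le_nhds)
  refine ge_of_tendsto hlim ?_
  filter_upwards [Ioo_mem_nhdsGT one_half_pos, nhdsWithin_le_nhds (hdet.eventually_const_lt hdet₀)]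
    with δ hδ hdetδ
  obtain ⟨C, hC⟩ := exists_sum_slopeScore_add_bounds c K hδ.1
  calc _ ≤ expGrowthSup (fun n ↦ P {ω | -C ≤ 1 * ∑ i, slackScore c δ (Z n ω i)}) := by
        refine expGrowthSup_monotone fun n ↦ measure_mono_ae ?_
        filter_upwards [hE n] with ω hω (hpos : 0 ≤ ∑ i, slopeScore c (Z n ω i + E n ω i))
        change -C ≤ 1 * ∑ i, slackScore c δ (Z n ω i)
        linarith [(hC n (Z n ω) (E n ω) hω).2]
    _ ≤ slackPressure c δ 1 := by
        rw [← expGrowthSup_lintegral_exp_mul_sum_slackScore hZ (by linarith [hδ.2]) hdetδ]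
        exact expGrowthSup_measure_ge_le (fun n ↦
          (aemeasurable_sum_slackScore (hZ n).aemeasurable c δ).const_mul 1) (-C)

lemma slackEntropy_le_expGrowthInf (hZ : ∀ n, HasLaw (Z n) (stdNormalPairs (Fin n)) P)
    (hE : ∀ n, ∀ᵐ ω ∂P, ∑ i, ((E n ω i).1 ^ 2 + (E n ω i).2 ^ 2) ≤ K) {c δ s : ℝ} (hδ : δ < 0)
    (hs : s * (2 * δ) < 1) (hdet : 0 < slackDet c δ s) (hslope : slackDetSlope c δ s < 0) :
    (slackEntropy c δ s : EReal) ≤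
      expGrowthInf (fun n ↦ P {ω | 0 < ∑ i, slopeScore c (Z n ω i + E n ω i)}) := by
  set m := -(slackDetSlope c δ s / (2 * slackDet c δ s)) with hm_def
  have hm : 0 < m := neg_pos.2 (div_neg_of_neg_of_pos hslope (by positivity))
  have hupper : ∀ᶠ t in 𝓝 s, expGrowthSup (fun n ↦
      ∫⁻ ω, ENNReal.ofReal (Real.exp (t * ∑ i, slackScore c δ (Z n ω i))) ∂P) ≤
      slackPressure c δ t := by
    have hcont : ContinuousAt (fun t ↦ t * (2 * δ)) s := by fun_prop
    filter_upwards [hcont.eventually_lt_const hs,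
      (hasDerivAt_slackDet c δ s).continuousAt.eventually_const_lt hdet] with t ht hdett
    exact (expGrowthSup_lintegral_exp_mul_sum_slackScore hZ ht hdett).le
  obtain ⟨C, hC⟩ := exists_sum_slopeScore_add_bounds c K (neg_pos.2 hδ)
  calc _ = ((slackPressure c δ s - s * m : ℝ) : EReal) := by
        rw [hm_def, mul_neg, sub_neg_eq_add, slackEntropy]
    _ ≤ expGrowthInf fun n ↦ P {ω | n * (m / 2) < ∑ i, slackScore c δ (Z n ω i)} :=
        le_expGrowthInf_measure_gt (fun n ↦ aemeasurable_sum_slackScore (hZ n).aemeasurable c δ)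
          hupper (expGrowthInf_lintegral_exp_mul_sum_slackScore hZ hs hdet).ge
          (hasDerivAt_slackPressure hdet) (half_lt_self hm)
    _ ≤ _ := by
        refine expGrowthInf_eventually_monotone ?_
        filter_upwards [(tendsto_natCast_atTop_atTop (R := ℝ)).eventually_ge_atTop (C / (m / 2))]
          with n hn
        refine measure_mono_ae ?_
        filter_upwards [hE n] with ω hω (hgt : n * (m / 2) < ∑ i, slackScore c δ (Z n ω i))
        change 0 < ∑ i, slopeScore c (Z n ω i + E n ω i)
        rw [div_le_iff₀ (by positivity)] at hn
        have hlow := (hC n (Z n ω) (E n ω) hω).1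
        rw [neg_neg] at hlow
        linarith

/-- The tilt `s` is taken beyond `1`, where the unperturbed pressure is minimal: the tilted mean is
then positive, so that its `n`-fold multiple outgrows the effect of the perturbation. -/
lemma slackEntropy_zero_le_expGrowthInf (hZ : ∀ n, HasLaw (Z n) (stdNormalPairs (Fin n)) P)
    (hE : ∀ n, ∀ᵐ ω ∂P, ∑ i, ((E n ω i).1 ^ 2 + (E n ω i).2 ^ 2) ≤ K) {c s : ℝ} (hc : c ≠ 0)
    (hs : s ∈ Ioo 1 2) :
    (slackEntropy c 0 s : EReal) ≤
      expGrowthInf (fun n ↦ P {ω | 0 < ∑ i, slopeScore c (Z n ω i + E n ω i)}) := by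
  have hdet : 0 < slackDet c 0 s := slackDet_zero_pos c ⟨by linarith [hs.1], hs.2.le⟩
  have hslope : slackDetSlope c 0 s < 0 := by
    rw [slackDetSlope_zero]
    exact mul_neg_of_pos_of_neg (by positivity) (sub_neg.2 hs.1)
  have hlim : Tendsto (fun δ ↦ (slackEntropy c δ s : EReal)) (𝓝[<] 0) (𝓝 (slackEntropy c 0 s)) :=
    EReal.tendsto_coe.2 ((continuousAt_slackEntropy continuousAt_id continuousAt_const
      hdet).tendsto.mono_left nhdsWithin_le_nhds)
  have hdet_near : ContinuousAt (fun δ ↦ slackDet c δ s) 0 := by fun_prop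
  have hslope_near : ContinuousAt (fun δ ↦ slackDetSlope c δ s) 0 := by fun_prop
  refine le_of_tendsto hlim ?_
  filter_upwards [self_mem_nhdsWithin, nhdsWithin_le_nhds (hdet_near.eventually_const_lt hdet),
    nhdsWithin_le_nhds (hslope_near.eventually_lt_const hslope)]
    with δ hδ hdetδ hslopeδ
  have hsδ : s * δ < 0 := mul_neg_of_pos_of_neg (zero_lt_one.trans hs.1) hδ
  exact slackEntropy_le_expGrowthInf hZ hE hδ (by linarith) hdetδ hslopeδ

lemma le_expGrowthInf_measure_sum_slopeScore_pos
    (hZ : ∀ n, HasLaw (Z n) (stdNormalPairs (Fin n)) P)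
    (hE : ∀ n, ∀ᵐ ω ∂P, ∑ i, ((E n ω i).1 ^ 2 + (E n ω i).2 ^ 2) ≤ K) {c : ℝ} (hc : c ≠ 0) :
    ((-(1 / 2 * Real.log (1 + c ^ 2)) : ℝ) : EReal) ≤
      expGrowthInf (fun n ↦ P {ω | 0 < ∑ i, slopeScore c (Z n ω i + E n ω i)}) := by
  have hlim : Tendsto (fun s ↦ (slackEntropy c 0 s : EReal)) (𝓝[>] 1) (𝓝 (slackEntropy c 0 1)) :=
    EReal.tendsto_coe.2 ((continuousAt_slackEntropy continuousAt_const continuousAt_id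
      (slackDet_zero_pos c (by norm_num))).tendsto.mono_left nhdsWithin_le_nhds)
  rw [← slackEntropy_zero_one]
  refine le_of_tendsto hlim ?_
  filter_upwards [Ioo_mem_nhdsGT one_lt_two] with s hs
  exact slackEntropy_zero_le_expGrowthInf hZ hE hc hs

theorem satisfiesLDP_regressionSlope [IsProbabilityMeasure P]
    (hZ : ∀ n, HasLaw (Z n) (stdNormalPairs (Fin n)) P) (hEm : ∀ n, AEMeasurable (E n) P)
    (hE : ∀ n, ∀ᵐ ω ∂P, ∑ i, ((E n ω i).1 ^ 2 + (E n ω i).2 ^ 2) ≤ K) (x₀ : ℝ) {κ : ℝ}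
    (hκ : κ ≠ 0) :
    SatisfiesLDP P (fun n ω ↦ regressionSlope fun i ↦ shear x₀ κ (Z n ω i + E n ω i))
      (fun n ↦ n) (slopeRate x₀ κ) := by
  refine satisfiesLDP_of_awayTail (x₀ := x₀) (fun n ↦ ?_)
    (continuous_slopeRate x₀ κ).lowerSemicontinuous (slopeRate_self x₀ κ)
    (fun x hx t ht ↦ slopeRate_lt_slopeRate_ray hκ hx ht) (fun x hx ↦ ?_) (fun x ↦ ?_)
  · have hslope : Measurable fun z : Fin n → ℝ × ℝ ↦ regressionSlope fun i ↦ shear x₀ κ (z i) := by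
      fun_prop
    exact hslope.comp_aemeasurable ((hZ n).aemeasurable.add (hEm n))
  · rw [coe_slopeRate, ← EReal.coe_neg]
    exact (le_expGrowthInf_measure_sum_slopeScore_pos hZ hE
      (div_ne_zero (sub_ne_zero.2 hx) hκ)).trans (expGrowthInf_monotone fun n ↦
        measure_mono fun ω hω ↦ mem_awayTail_of_sum_slopeScore_pos hκ hω)
  · rw [coe_slopeRate, ← EReal.coe_neg]
    exact (expGrowthSup_monotone fun n ↦ measure_mono fun ω hω ↦
      sum_slopeScore_nonneg_of_mem_awayTail hκ hω).trans
        (expGrowthSup_measure_sum_slopeScore_nonneg_le hZ hE _)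

end ScoreTails

section UnitGrid

variable {Ω : Type*}

/-- The point `i / n` of the unit interval. -/
noncomputable def unitGrid (n : ℕ) (i : Fin (n + 1)) : Icc (0 : ℝ) 1 :=
  ⟨(i : ℝ) / n, by positivity, div_le_one_of_le₀ (by exact_mod_cast i.is_le) (by positivity)⟩

lemma monotone_unitGrid (n : ℕ) : Monotone (unitGrid n) := by
  intro i j hij
  have : (i : ℝ) ≤ j := by exact_mod_cast hij
  change (i : ℝ) / n ≤ (j : ℝ) / n
  gcongr

lemma unitGrid_succ_sub_castSucc (n : ℕ) (i : Fin n) :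
    (unitGrid n i.succ : ℝ) - unitGrid n i.castSucc = 1 / n := by
  simp only [unitGrid, Fin.val_succ, Fin.val_castSucc]
  push_cast
  ring

lemma gridIncrement_eq_unitGrid (Z : ℝ → Ω → ℝ) (n : ℕ) (i : Fin n) (ω : Ω) :
    gridIncrement Z n (i + 1) ω =
      Z (unitGrid n i.succ) ω - Z (unitGrid n i.castSucc) ω := by
  simp [gridIncrement, unitGrid]

lemma sum_Icc_one_floor_eq_sum_fin (n : ℕ) (f : ℕ → ℝ) :
    ∑ k ∈ Finset.Icc 1 ⌊(n : ℝ) * 1⌋₊, f k = ∑ i : Fin n, f (i + 1) := by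
  rw [mul_one, Nat.floor_natCast, Fin.sum_univ_eq_sum_range (fun k ↦ f (k + 1)),
    Finset.range_eq_Ico, Finset.sum_Ico_add' f 0 n 1]
  rfl

lemma realizedRegression_one_eq_regressionSlope (X : Fin 2 → ℝ → Ω → ℝ) {ℓ ι : Fin 2} (hℓι : ℓ ≠ ι)
    (n : ℕ) (ω : Ω) :
    realizedRegression X ℓ n 1 ω = regressionSlope fun i : Fin n ↦
      (gridIncrement (X ℓ) n (i + 1) ω, gridIncrement (X ι) n (i + 1) ω) := by
  have hcov : ∀ k, gridIncrement (X 0) n k ω * gridIncrement (X 1) n k ω =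
      gridIncrement (X ℓ) n k ω * gridIncrement (X ι) n k ω := by
    intro k
    obtain ⟨rfl, rfl⟩ | ⟨rfl, rfl⟩ : ℓ = 0 ∧ ι = 1 ∨ ℓ = 1 ∧ ι = 0 := by omega
    exacts [rfl, mul_comm _ _]
  simp only [realizedRegression, realizedCovariance, realizedVariance, hcov]
  rw [sum_Icc_one_floor_eq_sum_fin n fun k ↦ gridIncrement (X ℓ) n k ω ^ 2,
    sum_Icc_one_floor_eq_sum_fin n fun k ↦ gridIncrement (X ℓ) n k ω * gridIncrement (X ι) n k ω]
  rfl

end UnitGrid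

section BrownianIncrements

variable {Ω : Type*} [MeasurableSpace Ω] {P : Measure Ω}

lemma IsStdBrownianOnUnit.hasLaw_gridIncrement {B : ℝ → Ω → ℝ} (hB : IsStdBrownianOnUnit P B)
    (n : ℕ) (i : Fin n) :
    HasLaw (fun ω ↦ √n * gridIncrement B n (i + 1) ω) (gaussianReal 0 1) P := by
  have hn : (0 : ℝ) < n := by exact_mod_cast i.pos
  have hscaled := gaussianReal_const_mul (hB.law_increment (unitGrid n i.castSucc)
    (unitGrid n i.succ) (unitGrid n i.castSucc).2.1
    (monotone_unitGrid n (Fin.castSucc_le_succ i)) (unitGrid n i.succ).2.2) (√n)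
  simp_rw [gridIncrement_eq_unitGrid]
  convert hscaled using 2
  · rw [mul_zero]
  · ext
    rw [unitGrid_succ_sub_castSucc, NNReal.coe_mul, NNReal.coe_mk, NNReal.coe_one,
      Real.coe_toNNReal _ (by positivity), Real.sq_sqrt hn.le, mul_one_div_cancel hn.ne']

lemma IsStdBrownianOnUnit.hasLaw_pi_gridIncrement [IsProbabilityMeasure P] {B : ℝ → Ω → ℝ}
    (hB : IsStdBrownianOnUnit P B) (n : ℕ) :
    HasLaw (fun ω (i : Fin n) ↦ √n * gridIncrement B n (i + 1) ω)
      (Measure.pi fun _ ↦ gaussianReal 0 1) P := by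
  have hind : iIndepFun (fun (i : Fin n) ω ↦ √n * gridIncrement B n (i + 1) ω) P := by
    simp_rw [gridIncrement_eq_unitGrid]
    exact (hB.indep_increments n (unitGrid n) (monotone_unitGrid n)).comp
      (fun _ x ↦ √n * x) (fun _ ↦ by fun_prop)
  exact hind.hasLaw_pi fun i ↦ hB.hasLaw_gridIncrement n i

lemma hasLaw_gridIncrement_pair [IsProbabilityMeasure P] {B W : ℝ → Ω → ℝ}
    (hB : IsStdBrownianOnUnit P B) (hW : IsStdBrownianOnUnit P W)
    (hBW : IndepFun (fun ω (t : Icc (0 : ℝ) 1) ↦ B t ω) (fun ω (t : Icc (0 : ℝ) 1) ↦ W t ω) P)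
    (n : ℕ) :
    HasLaw (fun ω (i : Fin n) ↦
      (√n * gridIncrement B n (i + 1) ω, √n * gridIncrement W n (i + 1) ω))
      (stdNormalPairs (Fin n)) P := by
  refine hasLaw_stdNormalPairs_of_indepFun (hB.hasLaw_pi_gridIncrement n)
    (hW.hasLaw_pi_gridIncrement n) ?_
  have hincr : Measurable fun (p : Icc (0 : ℝ) 1 → ℝ) (i : Fin n) ↦
      √n * (p (unitGrid n i.succ) - p (unitGrid n i.castSucc)) := by fun_prop
  simp_rw [gridIncrement_eq_unitGrid]
  exact hBW.comp hincr hincr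

lemma IsCorrelatedBrownianPair.exists_gridIncrement_eq [IsProbabilityMeasure P] {ρ : ℝ}
    (hρ : ρ ∈ Icc (-1) 1) {B : Fin 2 → ℝ → Ω → ℝ} (hB : IsCorrelatedBrownianPair P ρ B)
    {ℓ ι : Fin 2} (hℓι : ℓ ≠ ι) (n : ℕ) :
    ∃ Z : Ω → Fin n → ℝ × ℝ, HasLaw Z (stdNormalPairs (Fin n)) P ∧ ∀ᵐ ω ∂P, ∀ i : Fin n,
      √n * gridIncrement (B ℓ) n (i + 1) ω = (Z ω i).1 ∧
      √n * gridIncrement (B ι) n (i + 1) ω = ρ * (Z ω i).1 + √(1 - ρ ^ 2) * (Z ω i).2 := by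
  obtain ⟨hB₀, W, hW, hind, hB₁⟩ := hB
  have hlaw := hasLaw_gridIncrement_pair hB₀ hW hind n
  have hr : √(1 - ρ ^ 2) ^ 2 = 1 - ρ ^ 2 := Real.sq_sqrt (by nlinarith [hρ.1, hρ.2])
  have hincr : ∀ᵐ ω ∂P, ∀ i : Fin n, gridIncrement (B 1) n (i + 1) ω =
      ρ * gridIncrement (B 0) n (i + 1) ω + √(1 - ρ ^ 2) * gridIncrement W n (i + 1) ω := by
    filter_upwards [hB₁] with ω hω i
    simp_rw [gridIncrement_eq_unitGrid]
    rw [hω _ (unitGrid n i.succ).2, hω _ (unitGrid n i.castSucc).2]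
    ring
  obtain ⟨rfl, rfl⟩ | ⟨rfl, rfl⟩ : ℓ = 0 ∧ ι = 1 ∨ ℓ = 1 ∧ ι = 0 := by omega
  · refine ⟨_, hlaw, ?_⟩
    filter_upwards [hincr] with ω hω i
    refine ⟨rfl, ?_⟩
    rw [hω i]
    ring
  · refine ⟨_, hasLaw_stdNormalPairs_swap_rotation hlaw hρ, ?_⟩
    filter_upwards [hincr] with ω hω i
    constructor
    · rw [hω i]
      ring
    · linear_combination (-(√n * gridIncrement (B 0) n (i + 1) ω)) * hr

end BrownianIncrements

section Drift

variable {Ω : Type*}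

/-- The drift accumulated over the cell `[i / n, (i + 1) / n]`. -/
noncomputable def driftIncrement (b : ℝ → Ω → ℝ) (n : ℕ) (i : Fin n) (ω : Ω) : ℝ :=
  ∫ u in (unitGrid n i.castSucc : ℝ)..(unitGrid n i.succ), b u ω

/-- The perturbation of the pairs of standard normal variables that accounts for the drifts:
`shear x₀ κ` maps it to `s` times the pair of drift increments. -/
noncomputable def driftNoise (s x₀ κ : ℝ) (b b' : ℝ → Ω → ℝ) (n : ℕ) (ω : Ω) (i : Fin n) : ℝ × ℝ :=
  (s * driftIncrement b n i ω, s * ((driftIncrement b' n i ω - x₀ * driftIncrement b n i ω) / κ))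

lemma shear_add_driftNoise {κ : ℝ} (hκ : κ ≠ 0) (s x₀ : ℝ) (b b' : ℝ → Ω → ℝ) {n : ℕ} (ω : Ω)
    (i : Fin n) (p : ℝ × ℝ) :
    shear x₀ κ (p + driftNoise s x₀ κ b b' n ω i) =
      (p.1 + s * driftIncrement b n i ω, x₀ * p.1 + κ * p.2 + s * driftIncrement b' n i ω) := by
  simp only [shear, driftNoise, Prod.fst_add, Prod.snd_add, Prod.mk.injEq, true_and]
  field_simp
  ring

variable [MeasurableSpace Ω] {P : Measure Ω}

lemma IsBoundedDrift.exists_abs_integral_le [SFinite P] {b : ℝ → Ω → ℝ}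
    (hb : IsBoundedDrift P b) :
    ∃ K : ℝ, ∀ᵐ ω ∂P, IntervalIntegrable (fun s ↦ b s ω) volume 0 1 ∧
      ∀ s ∈ Icc (0 : ℝ) 1, ∀ t ∈ Icc (0 : ℝ) 1, |∫ u in s..t, b u ω| ≤ K * |t - s| := by
  obtain ⟨hmeas, hfin⟩ := hb
  set K : ℝ≥0∞ := eLpNormEssSup (fun p : ℝ × Ω ↦ b p.1 p.2)
    ((volume.restrict (Icc (0 : ℝ) 1)).prod P)
  have hK : K < ∞ := by rwa [eLpNorm_exponent_top] at hfin
  have hbound : ∀ᵐ p ∂((volume.restrict (Icc (0 : ℝ) 1)).prod P), ‖b p.1 p.2‖ ≤ K.toReal := by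
    filter_upwards [ae_le_eLpNormEssSup (f := fun p : ℝ × Ω ↦ b p.1 p.2)
      (μ := (volume.restrict (Icc (0 : ℝ) 1)).prod P)] with p hp
    rw [← toReal_enorm]
    exact ENNReal.toReal_mono hK.ne hp
  have hpath_bound : ∀ᵐ ω ∂P, ∀ᵐ s ∂(volume.restrict (Icc (0 : ℝ) 1)), ‖b s ω‖ ≤ K.toReal :=
    Measure.ae_ae_of_ae_prod (Measure.measurePreserving_swap.quasiMeasurePreserving.ae hbound)
  have hpath_meas : ∀ᵐ ω ∂P,
      AEStronglyMeasurable (fun s ↦ b s ω) (volume.restrict (Icc (0 : ℝ) 1)) :=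
    hmeas.prod_swap.prodMk_left
  refine ⟨K.toReal, ?_⟩
  filter_upwards [hpath_bound, hpath_meas] with ω hω hωm
  refine ⟨?_, fun s hs t ht ↦ ?_⟩
  · rw [intervalIntegrable_iff_integrableOn_Icc_of_le zero_le_one]
    exact Integrable.of_bound hωm _ hω
  · rw [← Real.norm_eq_abs]
    refine intervalIntegral.norm_integral_le_of_norm_le_const_ae ?_
    filter_upwards [(ae_restrict_iff' measurableSet_Icc).1 hω] with u hu hmem
    exact hu (uIoc_subset_uIcc.trans (uIcc_subset_Icc hs ht) hmem)

lemma IsBoundedDrift.aemeasurable_driftIncrement [SFinite P] {b : ℝ → Ω → ℝ}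
    (hb : IsBoundedDrift P b) {n : ℕ} (i : Fin n) : AEMeasurable (driftIncrement b n i) P := by
  have hle : (unitGrid n i.castSucc : ℝ) ≤ unitGrid n i.succ :=
    monotone_unitGrid n (Fin.castSucc_le_succ i)
  have hac : volume.restrict (Ioc (unitGrid n i.castSucc : ℝ) (unitGrid n i.succ)) ≪
      volume.restrict (Icc (0 : ℝ) 1) :=
    (Measure.restrict_mono (Ioc_subset_Icc_self.trans (Icc_subset_Icc (unitGrid n i.castSucc).2.1
      (unitGrid n i.succ).2.2)) le_rfl).absolutelyContinuous
  have hmeas : AEStronglyMeasurable (fun p : ℝ × Ω ↦ b p.1 p.2)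
      ((volume.restrict (Ioc (unitGrid n i.castSucc : ℝ) (unitGrid n i.succ))).prod P) :=
    hb.1.mono_ac (hac.prod Measure.AbsolutelyContinuous.rfl)
  unfold driftIncrement
  simp_rw [intervalIntegral.integral_of_le hle]
  exact hmeas.prod_swap.integral_prod_right'.aemeasurable

lemma IsBoundedDrift.exists_mul_sum_sq_driftIncrement_le [SFinite P] {b : ℝ → Ω → ℝ}
    (hb : IsBoundedDrift P b) :
    ∃ K : ℝ, ∀ᵐ ω ∂P, ∀ n : ℕ, n * ∑ i, driftIncrement b n i ω ^ 2 ≤ K := by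
  obtain ⟨K, hK⟩ := hb.exists_abs_integral_le
  refine ⟨K ^ 2, ?_⟩
  filter_upwards [hK] with ω hω n
  have hcell : ∀ i : Fin n, driftIncrement b n i ω ^ 2 ≤ (K * (1 / n)) ^ 2 := by
    intro i
    have habs := hω.2 _ (unitGrid n i.castSucc).2 _ (unitGrid n i.succ).2
    rw [unitGrid_succ_sub_castSucc, abs_of_nonneg (a := 1 / (n : ℝ)) (by positivity)] at habs
    exact sq_le_sq' (abs_le.1 habs).1 (abs_le.1 habs).2
  rcases n.eq_zero_or_pos with rfl | hn
  · simp only [CharP.cast_eq_zero, zero_mul]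
    positivity
  calc n * ∑ i, driftIncrement b n i ω ^ 2 ≤ n * ∑ _i : Fin n, (K * (1 / n)) ^ 2 :=
        mul_le_mul_of_nonneg_left (Finset.sum_le_sum fun i _ ↦ hcell i) n.cast_nonneg
    _ = K ^ 2 := by
        rw [Finset.sum_const, Finset.card_univ, Fintype.card_fin, nsmul_eq_mul]
        field_simp

lemma IsConstVolItoProcess.gridIncrement_eq [SFinite P] {σ : ℝ} {B b X : ℝ → Ω → ℝ}
    (hX : IsConstVolItoProcess P σ B b X) (hb : IsBoundedDrift P b) :
    ∀ᵐ ω ∂P, ∀ (n : ℕ) (i : Fin n), gridIncrement X n (i + 1) ω =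
      σ * gridIncrement B n (i + 1) ω + driftIncrement b n i ω := by
  obtain ⟨K, hK⟩ := hb.exists_abs_integral_le
  filter_upwards [hK, hX] with ω hω hXω n i
  have hint : ∀ t ∈ Icc (0 : ℝ) 1, IntervalIntegrable (fun s ↦ b s ω) volume 0 t := fun t ht ↦
    hω.1.mono_set (uIcc_subset_uIcc left_mem_uIcc (by rwa [uIcc_of_le zero_le_one]))
  simp_rw [gridIncrement_eq_unitGrid]
  rw [hXω _ (unitGrid n i.succ).2, hXω _ (unitGrid n i.castSucc).2, driftIncrement,
    ← intervalIntegral.integral_interval_sub_left (hint _ (unitGrid n i.succ).2)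
      (hint _ (unitGrid n i.castSucc).2)]
  ring

lemma aemeasurable_driftNoise [SFinite P] {b b' : ℝ → Ω → ℝ} (hb : IsBoundedDrift P b)
    (hb' : IsBoundedDrift P b') (s x₀ κ : ℝ) (n : ℕ) :
    AEMeasurable (driftNoise s x₀ κ b b' n) P := by
  refine aemeasurable_pi_lambda _ fun i ↦ ?_
  have hJ := hb.aemeasurable_driftIncrement i
  have hJ' := hb'.aemeasurable_driftIncrement i
  unfold driftNoise
  fun_prop

lemma exists_sum_sq_driftNoise_le [SFinite P] {b b' : ℝ → Ω → ℝ} (hb : IsBoundedDrift P b)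
    (hb' : IsBoundedDrift P b') (s x₀ κ : ℝ) :
    ∃ K : ℝ, ∀ n : ℕ, ∀ᵐ ω ∂P, ∑ i, ((driftNoise (√n * s) x₀ κ b b' n ω i).1 ^ 2 +
      (driftNoise (√n * s) x₀ κ b b' n ω i).2 ^ 2) ≤ K := by
  obtain ⟨K, hK⟩ := hb.exists_mul_sum_sq_driftIncrement_le
  obtain ⟨K', hK'⟩ := hb'.exists_mul_sum_sq_driftIncrement_le
  refine ⟨s ^ 2 * (K + 2 * (K' + x₀ ^ 2 * K) / κ ^ 2), fun n ↦ ?_⟩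
  filter_upwards [hK, hK'] with ω hω hω'
  set J := fun i ↦ driftIncrement b n i ω
  set J' := fun i ↦ driftIncrement b' n i ω
  have hsq : ∀ i, (J' i - x₀ * J i) ^ 2 ≤ 2 * (J' i ^ 2 + x₀ ^ 2 * J i ^ 2) := fun i ↦ by
    nlinarith [sq_nonneg (J' i + x₀ * J i)]
  calc ∑ i, ((√n * s * J i) ^ 2 + (√n * s * ((J' i - x₀ * J i) / κ)) ^ 2)
      = ∑ i, n * s ^ 2 * (J i ^ 2 + (J' i - x₀ * J i) ^ 2 / κ ^ 2) := by
        simp only [mul_pow, div_pow, Real.sq_sqrt n.cast_nonneg, mul_add]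
    _ ≤ ∑ i, n * s ^ 2 * (J i ^ 2 + 2 * (J' i ^ 2 + x₀ ^ 2 * J i ^ 2) / κ ^ 2) := by
        gcongr with i
        exact hsq i
    _ = s ^ 2 * (n * ∑ i, J i ^ 2 +
          2 * (n * ∑ i, J' i ^ 2 + x₀ ^ 2 * (n * ∑ i, J i ^ 2)) / κ ^ 2) := by
        simp only [Finset.mul_sum, ← Finset.sum_add_distrib, Finset.sum_div]
        exact Finset.sum_congr rfl fun i _ ↦ by ring
    _ ≤ s ^ 2 * (K + 2 * (K' + x₀ ^ 2 * K) / κ ^ 2) := by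
        gcongr
        exacts [hω n, hω' n, hω n]

end Drift

lemma realizedRegression_ae_eq {Ω : Type*} [MeasurableSpace Ω] {P : Measure Ω} [SFinite P]
    {σ : Fin 2 → ℝ} {ρ r : ℝ} {B b X : Fin 2 → ℝ → Ω → ℝ} (hb : ∀ i, IsBoundedDrift P (b i))
    (hX : ∀ i, IsConstVolItoProcess P (σ i) (B i) (b i) (X i)) {ℓ ι : Fin 2} (hℓι : ℓ ≠ ι)
    (hσℓ : σ ℓ ≠ 0) (hσι : σ ι ≠ 0) (hr : r ≠ 0) {n : ℕ} {Z : Ω → Fin n → ℝ × ℝ}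
    (hBZ : ∀ᵐ ω ∂P, ∀ i : Fin n, √n * gridIncrement (B ℓ) n (i + 1) ω = (Z ω i).1 ∧
      √n * gridIncrement (B ι) n (i + 1) ω = ρ * (Z ω i).1 + r * (Z ω i).2) :
    (fun ω ↦ regressionSlope fun i ↦ shear (ρ * σ ι / σ ℓ) (σ ι * r / σ ℓ) (Z ω i +
      driftNoise (√n * (σ ℓ)⁻¹) (ρ * σ ι / σ ℓ) (σ ι * r / σ ℓ) (b ℓ) (b ι) n ω i)) =ᵐ[P]
      fun ω ↦ realizedRegression X ℓ n 1 ω := by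
  rcases n.eq_zero_or_pos with rfl | hn
  · simp [realizedRegression_one_eq_regressionSlope X hℓι, regressionSlope]
  have hscale : √n * (σ ℓ)⁻¹ ≠ 0 := by positivity
  filter_upwards [hBZ, (hX ℓ).gridIncrement_eq (hb ℓ), (hX ι).gridIncrement_eq (hb ι)]
    with ω hω hωℓ hωι
  rw [realizedRegression_one_eq_regressionSlope X hℓι]
  refine Eq.trans ?_ (regressionSlope_const_mul hscale _)
  congr 1
  funext i
  rw [shear_add_driftNoise (by positivity), hωℓ, hωι, ← (hω i).1, Prod.mk.injEq]
  constructor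
  · field_simp
  · have hι := (hω i).2
    rw [← (hω i).1] at hι
    field_simp
    linear_combination -(σ ι * hι)

lemma slopeRate_regression {s t ρ : ℝ} (hs : s ≠ 0) (hρ : 0 ≤ 1 - ρ ^ 2) (u : ℝ) :
    slopeRate (ρ * t / s) (t * √(1 - ρ ^ 2) / s) u = ENNReal.ofReal
      (1 / 2 * Real.log (1 + (s * u - ρ * t) ^ 2 / (t ^ 2 * (1 - ρ ^ 2)))) := by
  have hsub : u - ρ * t / s = (s * u - ρ * t) / s := by field_simp
  rw [slopeRate, hsub, div_div_div_cancel_right₀ hs, div_pow, mul_pow t, Real.sq_sqrt hρ]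

theorem mainTheorem11 {Ω : Type*} [MeasurableSpace Ω] (P : Measure Ω) [IsProbabilityMeasure P]
    (σ : Fin 2 → ℝ) (hσ : ∀ i, 0 < σ i) (ρ : ℝ) (hρ : ρ ∈ Ioo (-1 : ℝ) 1)
    (B b X : Fin 2 → ℝ → Ω → ℝ)
    (hB : IsCorrelatedBrownianPair P ρ B)
    (hb : ∀ i, IsBoundedDrift P (b i))
    (hX : ∀ i, IsConstVolItoProcess P (σ i) (B i) (b i) (X i))
    (ℓ ι : Fin 2) (hℓι : ℓ ≠ ι) :
    SatisfiesLDP P (fun n ω => realizedRegression X ℓ n 1 ω) (fun n => (n : ℝ))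
        (fun u : ℝ => ENNReal.ofReal
          (1 / 2 * Real.log (1 + (σ ℓ * u - ρ * σ ι) ^ 2 / (σ ι ^ 2 * (1 - ρ ^ 2))))) ∧
      IsGoodRateFunction
        (fun u : ℝ => ENNReal.ofReal
          (1 / 2 * Real.log (1 + (σ ℓ * u - ρ * σ ι) ^ 2 / (σ ι ^ 2 * (1 - ρ ^ 2))))) := by
  have hσℓ := (hσ ℓ).ne'
  have hσι := (hσ ι).ne'
  have hρ_sq : 0 < 1 - ρ ^ 2 := by nlinarith [hρ.1, hρ.2]
  have hr : √(1 - ρ ^ 2) ≠ 0 := (Real.sqrt_pos.2 hρ_sq).ne'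
  set x₀ := ρ * σ ι / σ ℓ
  set κ := σ ι * √(1 - ρ ^ 2) / σ ℓ
  have hκ : κ ≠ 0 := by positivity
  simp_rw [← slopeRate_regression hσℓ hρ_sq.le]
  refine ⟨?_, isGoodRateFunction_slopeRate hκ⟩
  choose Z hZ hBZ using hB.exists_gridIncrement_eq ⟨hρ.1.le, hρ.2.le⟩ hℓι
  obtain ⟨K, hK⟩ := exists_sum_sq_driftNoise_le (hb ℓ) (hb ι) (σ ℓ)⁻¹ x₀ κ
  exact (satisfiesLDP_regressionSlope hZ
    (fun n ↦ aemeasurable_driftNoise (hb ℓ) (hb ι) (√n * (σ ℓ)⁻¹) x₀ κ n) hK x₀ hκ).congr_ae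
    fun n ↦ realizedRegression_ae_eq hb hX hℓι hσℓ hσι hr (hBZ n)
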